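/- All manifolds are smooth, Hausdorff, finite-dimensional and without boundary; $M$ is connected, and $k\ge 1$. Definitions. A $k$-contact form on $M$ is a smooth $\boldsymbol\eta\in\Omega^1(M,\mathbb R^k)$ such that $\ker\boldsymbol\eta$ is a non-zero distribution of constant corank $k$, $\ker\mathrm d\boldsymbol\eta=\{v:\iota_v\mathrm d\boldsymbol\eta=0\}$ is a distribution of constant rank $k$, and $\ker\boldsymbol\eta\cap\ker\mathrm d\boldsymbol\eta=0$. Its Reeb vector fields $R_1,\dots,R_k$ are determined by $\iota_{R_\alpha}\boldsymbol\eta=e_\alpha$ and $\iota_{R_\alpha}\mathrm d\boldsymbol\eta=0$. A vector field $Y$ is $\boldsymbol\eta$-Hamiltonian if $[Y,Z]$ takes values in $\ker\boldsymbol\eta$ whenever the vector field $Z$ does; its $\boldsymbol\eta$-Hamiltonian $k$-function is $-\iota_Y\boldsymbol\eta$. A $t$-dependent vector field $X=(X_t)_{t\in\mathbb R}$ is a Lie system if all the $X_t$ lie in one finite-dimensional real Lie algebra of vector fields (a Vessiot–Guldberg Lie algebra of $X$); $V^X$ is the smallest Lie algebra of vector fields containing all $X_t$. The triple $(M,\boldsymbol\eta,X)$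 is a projectable $k$-contact Lie system if $\boldsymbol\eta$ is a $k$-contact form, $X$ is a Lie system, every element of $V^X$ is $\boldsymbol\eta$-Hamiltonian, and the $\boldsymbol\eta$-Hamiltonian $k$-functions of the elements of $V^X$ are first integrals of $R_1,\dots,R_k$. A $k$-symplectic form is a closed two-form $\boldsymbol\omega$ with values in $\mathbb R^k$ and $\ker\boldsymbol\omega=0$; a vector field $Y$ is $\boldsymbol\omega$-Hamiltonian if $\iota_Y\boldsymbol\omega=\mathrm d\boldsymbol g$ for some smooth $\mathbb R^k$-valued function $\boldsymbol g$; a $k$-symplectic Lie system is a Lie system admitting a Vessiot–Guldberg Lie algebra of $\boldsymbol\omega$-Hamiltonian vector fields, for a $k$-symplectic form $\boldsymbol\omega$. Proposition. Let $(M,\boldsymbol\eta,X)$ be a projectable $k$-contact Lie system. Let $M/\mathcal D^R$ be the space of leaves of the Reeb distribution $\mathcal D^R=\ker\mathrm d\boldsymbol\eta$ (two points being on the same leaf when they are joined by a piecewise $C^1$ curve tangent to $\mathcal D^R$), with its quotient topology, and assume that it carries a manifold structure for which the canonical projection $\mathfrak p_R:M\to M/\mathcal D^R$ is a smooth submersion.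 Then there is a unique $\mathbb R^k$-valued two-form $\boldsymbol\omega$ on $M/\mathcal D^R$ with $\mathfrak p_R^*\boldsymbol\omega=\mathrm d\boldsymbol\eta$, and it is a $k$-symplectic form. Moreover, there is a unique $t$-dependent vector field $\mathfrak p_{R*}X$ on $M/\mathcal D^R$ with $\mathrm T\mathfrak p_R\circ X_t=(\mathfrak p_{R*}X)_t\circ\mathfrak p_R$ for all $t\in\mathbb R$, the triple $(M/\mathcal D^R,\boldsymbol\omega,\mathfrak p_{R*}X)$ is a $k$-symplectic Lie system, and each vector field $(\mathfrak p_{R*}X)_t$ is $\boldsymbol\omega$-Hamiltonian. If $X$ is smooth as a map $\mathbb R\times M\to\mathrm TM$, then $\mathfrak p_{R*}X$ is smooth as a map $\mathbb R\times M/\mathcal D^R\to\mathrm T(M/\mathcal D^R)$. -/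

import Mathlib

open scoped Manifold ContDiff

noncomputable section

namespace KContact

section Basic

variable (E : Type*) [NormedAddCommGroup E] [NormedSpace ℝ E]
  (M : Type*) [TopologicalSpace M] [ChartedSpace E M]

/-- (Not necessarily smooth) vector fields on `M`. -/
abbrev VField : Type _ := ∀ x : M, TangentSpace 𝓘(ℝ, E) x

/-- (Not necessarily smooth) differential `n`-forms on `M` with values in `ℝ^k`. -/
abbrev DForm (n k : ℕ) : Type _ :=
  ∀ x : M, TangentSpace 𝓘(ℝ, E) x [⋀^Fin n]→L[ℝ] (Fin k → ℝ)

end Basic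

section Forms

variable {E : Type*} [NormedAddCommGroup E] [NormedSpace ℝ E]
  {M : Type*} [TopologicalSpace M] [ChartedSpace E M]
  {E' : Type*} [NormedAddCommGroup E'] [NormedSpace ℝ E']
  {N : Type*} [TopologicalSpace N] [ChartedSpace E' N] {n k : ℕ}

/-- The coordinate expression of `Ω` in the preferred chart at `x₀`, i.e. the pullback of `Ω` by
the inverse of that chart. It is meaningful on the target of the chart. -/
def localRep (Ω : DForm E M n k) (x₀ : M) (y : E) : E [⋀^Fin n]→L[ℝ] (Fin k → ℝ) :=
  (Ω ((extChartAt 𝓘(ℝ, E) x₀).symm y)).compContinuousLinearMap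
    (mfderiv 𝓘(ℝ, E) 𝓘(ℝ, E) (extChartAt 𝓘(ℝ, E) x₀).symm y)

/-- A form is smooth if all its coordinate expressions are smooth. -/
def IsSmoothForm (Ω : DForm E M n k) : Prop :=
  ∀ x₀ : M, ContDiffOn ℝ ∞ (localRep Ω x₀) (extChartAt 𝓘(ℝ, E) x₀).target

/-- The exterior derivative, computed at `x` in the preferred chart at `x`. -/
def dExt (Ω : DForm E M n k) : DForm E M (n + 1) k := fun x =>
  (extDeriv (localRep Ω x) (extChartAt 𝓘(ℝ, E) x x)).compContinuousLinearMap
    (mfderiv 𝓘(ℝ, E) 𝓘(ℝ, E) (extChartAt 𝓘(ℝ, E) x) x)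

/-- The pullback `f^* Ω`. -/
def pullbackForm (f : M → N) (Ω : DForm E' N n k) : DForm E M n k := fun x =>
  (Ω (f x)).compContinuousLinearMap (mfderiv 𝓘(ℝ, E) 𝓘(ℝ, E') f x)

/-- The kernel at `x` of an `ℝ^k`-valued form of positive degree: the tangent vectors `v` with
`ι_v Ω = 0`. -/
def kerForm (Ω : DForm E M (n + 1) k) (x : M) : Submodule ℝ (TangentSpace 𝓘(ℝ, E) x) where
  carrier := {v | ∀ w : Fin n → TangentSpace 𝓘(ℝ, E) x, Ω x (Fin.cons v w) = 0}
  add_mem' := by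
    intro a b ha hb w
    have := (Ω x).toMultilinearMap.cons_add w a b
    simpa [ha w, hb w] using this
  zero_mem' := fun w => (Ω x).map_coord_zero 0 (by simp)
  smul_mem' := by
    intro c a ha w
    have := (Ω x).toMultilinearMap.cons_smul w c a
    simpa [ha w] using this

/-- `k`-contact forms. -/
structure IsKContactForm (η : DForm E M 1 k) : Prop where
  smooth : IsSmoothForm η
  ker_ne_bot : ∀ x, kerForm η x ≠ ⊥
  corank_ker : ∀ x, Module.finrank ℝ (kerForm η x) + k = Module.finrank ℝ E
  rank_ker_d : ∀ x, Module.finrank ℝ (kerForm (dExt η) x) = k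
  inf_eq_bot : ∀ x, kerForm η x ⊓ kerForm (dExt η) x = ⊥

/-- `x` and `y` are joined by a `C^1` curve tangent to the distribution `ker dη`. -/
def TangentlyJoined (η : DForm E M 1 k) (x y : M) : Prop :=
  ∃ γ : ℝ → M, ContMDiff 𝓘(ℝ, ℝ) 𝓘(ℝ, E) 1 γ ∧
    (∀ t : ℝ, mfderiv 𝓘(ℝ, ℝ) 𝓘(ℝ, E) γ t (1 : ℝ) ∈ kerForm (dExt η) (γ t)) ∧
    γ 0 = x ∧ γ 1 = y

/-- Two points are equivalent when they lie on the same leaf of the Reeb distribution `ker dη`,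
i.e. when they are joined by a finite chain of curves tangent to it. -/
def leafSetoid (η : DForm E M 1 k) : Setoid M := Relation.EqvGen.setoid (TangentlyJoined η)

/-- The leaf space `M / ker dη` of the Reeb distribution, with the quotient topology. -/
abbrev LeafSpace (η : DForm E M 1 k) : Type _ := Quotient (leafSetoid η)

/-- The canonical projection `p_R : M → M / ker dη`. -/
def leafProj (η : DForm E M 1 k) : M → LeafSpace η := Quotient.mk (leafSetoid η)

/-- `k`-symplectic forms: closed nondegenerate `ℝ^k`-valued two-forms. -/
structure IsKSymplecticForm (Ω : DForm E M 2 k) : Prop where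
  smooth : IsSmoothForm Ω
  closed : dExt Ω = 0
  nondegenerate : ∀ x, kerForm Ω x = ⊥

/-- The `η`-Hamiltonian `k`-function `-ι_Y η` of `Y`. -/
def hamFun (η : DForm E M 1 k) (Y : VField E M) : M → (Fin k → ℝ) := fun x => -(η x ![Y x])

/-- The `t`-dependent vector field `X'` is the pushforward `f_* X`. -/
def IsPushforward (f : M → N) (X : ℝ → VField E M) (X' : ℝ → VField E' N) : Prop :=
  ∀ t x, mfderiv 𝓘(ℝ, E) 𝓘(ℝ, E') f x (X t x) = X' t (f x)

end Forms

section Systems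

variable {E : Type*} [NormedAddCommGroup E] [NormedSpace ℝ E]
  {M : Type*} [TopologicalSpace M] [ChartedSpace E M] [IsManifold 𝓘(ℝ, E) ∞ M]
  {k : ℕ}

/-- Smoothness of a vector field. -/
def IsSmoothVF (Y : VField E M) : Prop :=
  ContMDiff 𝓘(ℝ, E) 𝓘(ℝ, E).tangent ∞ (fun x => (⟨x, Y x⟩ : TangentBundle 𝓘(ℝ, E) M))

/-- `V` is a (real) Lie algebra of smooth vector fields. -/
structure IsLieAlgebraOfVF (V : Submodule ℝ (VField E M)) : Prop where
  smooth : ∀ Y ∈ V, IsSmoothVF Y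
  lie_mem : ∀ Y ∈ V, ∀ Z ∈ V, VectorField.mlieBracket 𝓘(ℝ, E) Y Z ∈ V

/-- The smallest Lie algebra `V^X` of smooth vector fields containing all the `X_t`. -/
def smallestLieAlgebra (X : ℝ → VField E M) : Submodule ℝ (VField E M) :=
  sInf {V | IsLieAlgebraOfVF V ∧ ∀ t, X t ∈ V}

/-- `V` is a Vessiot--Guldberg Lie algebra of `X`: a finite-dimensional Lie algebra of vector
fields such that, for a basis `X_1, …, X_r` of `V`, one has `X_t = ∑ b_α(t) X_α`. -/
structure IsVessiotGuldberg (X : ℝ → VField E M) (V : Submodule ℝ (VField E M)) : Prop where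
  lieAlgebra : IsLieAlgebraOfVF V
  finiteDimensional : FiniteDimensional ℝ V
  mem : ∀ t, X t ∈ V

/-- A `t`-dependent vector field is a Lie system if it admits a Vessiot--Guldberg Lie algebra. -/
def IsLieSystem (X : ℝ → VField E M) : Prop := ∃ V, IsVessiotGuldberg X V

/-- Joint smoothness of `X` as a map `ℝ × M → TM`. -/
def IsJointlySmooth (X : ℝ → VField E M) : Prop :=
  ContMDiff (𝓘(ℝ, ℝ).prod 𝓘(ℝ, E)) 𝓘(ℝ, E).tangent ∞
    (fun q : ℝ × M => (⟨q.2, X q.1 q.2⟩ : TangentBundle 𝓘(ℝ, E) M))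

/-- `R_1, …, R_k` are the Reeb vector fields of `η`: `ι_{R_α} η = e_α` and `ι_{R_α} dη = 0`. -/
structure IsReebFamily (η : DForm E M 1 k) (R : Fin k → VField E M) : Prop where
  smooth : ∀ α, IsSmoothVF (R α)
  apply : ∀ α x, η x ![R α x] = Pi.single α 1
  mem_ker : ∀ α x, R α x ∈ kerForm (dExt η) x

/-- `η`-Hamiltonian vector fields: Lie symmetries of the distribution `ker η`. -/
structure IsEtaHamiltonian (η : DForm E M 1 k) (Y : VField E M) : Prop where
  smooth : IsSmoothVF Y
  lie_symm : ∀ Z : VField E M, IsSmoothVF Z → (∀ x, Z x ∈ kerForm η x) →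
    ∀ x, VectorField.mlieBracket 𝓘(ℝ, E) Y Z x ∈ kerForm η x

/-- `(M, η, X)` is a `k`-contact Lie system. -/
structure IsKContactLieSystem (η : DForm E M 1 k) (X : ℝ → VField E M) : Prop where
  kcontact : IsKContactForm η
  lieSystem : IsLieSystem X
  hamiltonian : ∀ Y ∈ smallestLieAlgebra X, IsEtaHamiltonian η Y

/-- `(M, η, X)` is a projectable `k`-contact Lie system: the `η`-Hamiltonian `k`-functions of the
elements of `V^X` are first integrals of the Reeb vector fields. -/
structure IsProjectable (η : DForm E M 1 k) (X : ℝ → VField E M) : Prop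
    extends IsKContactLieSystem η X where
  first_integral : ∀ Y ∈ smallestLieAlgebra X, ∀ R : Fin k → VField E M, IsReebFamily η R →
    ∀ α x, mvfderiv 𝓘(ℝ, E) (hamFun η Y) x (R α x) = 0

/-- `Ω`-Hamiltonian vector fields: `ι_Y Ω = dg` for a smooth `k`-function `g`. -/
def IsOmegaHamiltonian (Ω : DForm E M 2 k) (Y : VField E M) : Prop :=
  IsSmoothVF Y ∧ ∃ g : M → (Fin k → ℝ), ContMDiff 𝓘(ℝ, E) 𝓘(ℝ, Fin k → ℝ) ∞ g ∧
    ∀ x v, Ω x ![Y x, v] = mvfderiv 𝓘(ℝ, E) g x v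

/-- `(M, Ω, X)` is a `k`-symplectic Lie system: `Ω` is `k`-symplectic and `X` is a Lie system
admitting a Vessiot--Guldberg Lie algebra of `Ω`-Hamiltonian vector fields. -/
structure IsKSymplecticLieSystem (Ω : DForm E M 2 k) (X : ℝ → VField E M) : Prop where
  ksymplectic : IsKSymplecticForm Ω
  hamiltonian : ∃ V, IsVessiotGuldberg X V ∧ ∀ Y ∈ V, IsOmegaHamiltonian Ω Y

end Systems

end KContact

end

/-
The kernel of `dη` is spanned by the Reeb vector fields. In a chart, tangency to it is the total
differential equation `Dψ = A ∘ ψ`, whose compatibility condition is that the Reeb fields commute;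
its solutions are `k`-dimensional plaques tangent to `ker dη`. Following plaques through rational
parameters shows that a leaf meets a chart domain in countably many plaques. The fibres of
`p = leafProj η` being the leaves, a comparison of Hausdorff dimensions gives `ker dp = ker dη`
at every point.

The form `dη` is closed and annihilated by `ker dp`, so it takes the same values along a plaque,
hence along a leaf, and descends to a form `Ω` on the leaf space. Local sections of `p` make `Ω`
smooth and closed, and `ker dp = ker dη` makes it nondegenerate.

For an `η`-Hamiltonian field `Y` with first integral `h = -ι_Y η`, Cartan's formula gives
`ι_Y dη = dh`. The function `h` is constant on leaves, hence `h = g ∘ p`, and nondegeneracy of `Ω`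
forces `Y` to project to the field `Y'` with `ι_{Y'} Ω = dg`. The projections of the elements of
`V^X` then form a Vessiot-Guldberg algebra of the projected system.
-/

noncomputable section

open Set Metric Filter Topology
open scoped NNReal

namespace KContact

section TotalDifferentialEquations

variable {E : Type*} [NormedAddCommGroup E] [NormedSpace ℝ E]
  {W : Type*} [NormedAddCommGroup W] [NormedSpace ℝ W]

theorem lipschitzOnWith_clm_apply {A : E → W →L[ℝ] E} {K c : ℝ≥0} {s : Set E} {w : W}
    (hA : LipschitzOnWith K A s) (hw : ‖w‖ ≤ c) : LipschitzOnWith (K * c) (fun y => A y w) s := by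
  refine LipschitzOnWith.of_dist_le_mul fun p hp q hq => ?_
  calc dist (A p w) (A q w) = ‖(A p - A q) w‖ := by rw [dist_eq_norm, sub_apply]
    _ ≤ ‖A p - A q‖ * ‖w‖ := (A p - A q).le_opNorm w
    _ ≤ (K * dist p q) * c := by gcongr; simpa [dist_eq_norm] using hA.dist_le_mul p hp q hq
    _ = ↑(K * c) * dist p q := by push_cast; ring

/-- `y` solves on `[0, 1]` the ordinary differential equation `y' = A(y) w`, `y 0 = x₀`: this is
the restriction to the ray `t ↦ t w` of the total differential equation `Dψ = A(ψ)`. -/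
structure IsRaySolution (A : E → W →L[ℝ] E) (x₀ : E) (w : W) (y : ℝ → E) : Prop where
  map_zero : y 0 = x₀
  hasDerivWithinAt : ∀ t ∈ Icc (0 : ℝ) 1, HasDerivWithinAt y (A (y t) w) (Icc 0 1) t

namespace IsRaySolution

variable {A : E → W →L[ℝ] E} {x₀ : E} {w : W} {y : ℝ → E}

theorem continuousOn (hy : IsRaySolution A x₀ w y) : ContinuousOn y (Icc 0 1) :=
  fun t ht => (hy.hasDerivWithinAt t ht).continuousWithinAt

theorem hasDerivWithinAt_Ici (hy : IsRaySolution A x₀ w y) {t : ℝ} (ht : t ∈ Ico (0 : ℝ) 1) :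
    HasDerivWithinAt y (A (y t) w) (Ici t) t :=
  (hy.hasDerivWithinAt t ⟨ht.1, ht.2.le⟩).mono_of_mem_nhdsWithin (Icc_mem_nhdsGE_of_mem ht)

theorem apply_one_of_zero (hy : IsRaySolution A x₀ (0 : W) y) : y 1 = x₀ := by
  rw [← hy.map_zero]
  refine constant_of_has_deriv_right_zero hy.continuousOn (fun t ht => ?_) 1 (by simp)
  simpa using hy.hasDerivWithinAt_Ici ht

/-- A solution that reaches the sphere of radius `a t` at the time `t` has speed less than `a`
there, so it never crosses these growing spheres. -/
theorem mem_closedBall (hy : IsRaySolution A x₀ w y) {L a : ℝ} (ha : 0 ≤ a)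
    (hL : ∀ x ∈ closedBall x₀ a, ‖A x‖ ≤ L) (hw : L * ‖w‖ < a) :
    ∀ t ∈ Icc (0 : ℝ) 1, y t ∈ closedBall x₀ a := by
  have hbound := image_norm_le_of_norm_deriv_right_lt_deriv_boundary (a := 0) (b := 1)
    (f := fun t => y t - x₀) (f' := fun t => A (y t) w) (B := fun t => a * t) (B' := fun _ => a)
    (hy.continuousOn.sub continuousOn_const) (fun t ht => (hy.hasDerivWithinAt_Ici ht).sub_const x₀)
    (by simp [hy.map_zero]) (fun t => by simpa using (hasDerivAt_id t).const_mul a)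
    fun t ht heq => ?_
  · intro t ht
    rw [mem_closedBall_iff_norm]
    nlinarith [hbound ht, ht.1, ht.2]
  · have hmem : y t ∈ closedBall x₀ a := by
      rw [mem_closedBall_iff_norm, heq]
      nlinarith [ht.1, ht.2]
    exact ((A (y t)).le_opNorm w).trans_lt
      ((mul_le_mul_of_nonneg_right (hL _ hmem) (norm_nonneg w)).trans_lt hw)

end IsRaySolution

theorem exists_isRaySolution [CompleteSpace E] {A : E → W →L[ℝ] E} {x₀ : E} {w : W} {a L K : ℝ≥0}
    (hK : LipschitzOnWith K A (closedBall x₀ a)) (hL : ∀ x ∈ closedBall x₀ (a : ℝ), ‖A x‖ ≤ L)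
    (hw : L * ‖w‖ ≤ a) : ∃ y, IsRaySolution A x₀ w y := by
  have hPL : IsPicardLindelof (fun _ x => A x w) (tmin := 0) (tmax := 1) ⟨0, by simp⟩ x₀ a 0
      (L * ‖w‖₊) (K * ‖w‖₊) := by
    refine .of_time_independent (fun x hx => ?_) (lipschitzOnWith_clm_apply hK le_rfl)
      (by simpa using hw)
    exact ((A x).le_opNorm w).trans (by push_cast; gcongr; exact hL x hx)
  obtain ⟨y, hy₀, hy⟩ := hPL.exists_eq_forall_mem_Icc_hasDerivWithinAt₀
  exact ⟨y, hy₀, hy⟩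

/-- The quantitative form, on a set `S`, of the hypotheses of Frobenius' theorem for the total
differential equation `Dψ = A(ψ)`; `symm` is the integrability condition, which expresses that
`D²ψ` is symmetric. -/
structure IntegrableOnWith (A : E → W →L[ℝ] E) (S : Set E) (L K K' : ℝ≥0) : Prop where
  differentiableAt : ∀ x ∈ S, DifferentiableAt ℝ A x
  norm_le : ∀ x ∈ S, ‖A x‖ ≤ L
  norm_fderiv_le : ∀ x ∈ S, ‖fderiv ℝ A x‖ ≤ K
  lipschitzOnWith_fderiv : LipschitzOnWith K' (fderiv ℝ A) S
  symm : ∀ x ∈ S, ∀ u w, fderiv ℝ A x (A x w) u = fderiv ℝ A x (A x u) w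

theorem exists_integrableOnWith_closedBall {A : E → W →L[ℝ] E} {x₀ : E} (hA : ContDiffAt ℝ 2 A x₀)
    (hsymm : ∀ᶠ x in 𝓝 x₀, ∀ u w, fderiv ℝ A x (A x w) u = fderiv ℝ A x (A x u) w) :
    ∃ a : ℝ≥0, 0 < a ∧ ∃ L K K' : ℝ≥0, 0 < L ∧
      IntegrableOnWith A (closedBall x₀ (2 * a)) L K K' := by
  have hdA : ContDiffAt ℝ 1 (fderiv ℝ A) x₀ := hA.fderiv_right (by norm_num)
  obtain ⟨K', s, hs, hK'⟩ := hdA.exists_lipschitzOnWith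
  have hdiff : ∀ᶠ x in 𝓝 x₀, DifferentiableAt ℝ A x :=
    (hA.eventually (by simp)).mono fun x hx => hx.differentiableAt (by simp)
  have hL : ∀ᶠ x in 𝓝 x₀, ‖A x‖ < ‖A x₀‖ + 1 :=
    hA.continuousAt.norm.eventually_lt_const (lt_add_one _)
  have hK : ∀ᶠ x in 𝓝 x₀, ‖fderiv ℝ A x‖ < ‖fderiv ℝ A x₀‖ + 1 :=
    (ContinuousAt.norm (f := fderiv ℝ A) hdA.continuousAt).eventually_lt_const (lt_add_one _)
  obtain ⟨ρ, hρ, hball⟩ := nhds_basis_closedBall.mem_iff.1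
    (inter_mem hs (hdiff.and (hL.and (hK.and hsymm))))
  have hsub : closedBall x₀ (2 * (ρ / 2)) ⊆ closedBall x₀ ρ := by rw [mul_div_cancel₀ ρ two_ne_zero]
  lift ρ to ℝ≥0 using hρ.le
  exact ⟨ρ / 2, half_pos hρ, ‖A x₀‖₊ + 1, ‖fderiv ℝ A x₀‖₊ + 1, K', by positivity,
    { differentiableAt := fun x hx => (hball (hsub hx)).2.1
      norm_le := fun x hx => (hball (hsub hx)).2.2.1.le
      norm_fderiv_le := fun x hx => (hball (hsub hx)).2.2.2.1.le
      lipschitzOnWith_fderiv := hK'.mono fun x hx => (hball (hsub hx)).1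
      symm := fun x hx => (hball (hsub hx)).2.2.2.2 }⟩

namespace IntegrableOnWith

variable {A : E → W →L[ℝ] E} {S : Set E} {L K K' : ℝ≥0}

theorem mono (hA : IntegrableOnWith A S L K K') {S' : Set E} (h : S' ⊆ S) :
    IntegrableOnWith A S' L K K' where
  differentiableAt x hx := hA.differentiableAt x (h hx)
  norm_le x hx := hA.norm_le x (h hx)
  norm_fderiv_le x hx := hA.norm_fderiv_le x (h hx)
  lipschitzOnWith_fderiv := hA.lipschitzOnWith_fderiv.mono h
  symm x hx := hA.symm x (h hx)

theorem lipschitzOnWith (hA : IntegrableOnWith A S L K K') (hS : Convex ℝ S) :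
    LipschitzOnWith K A S :=
  hS.lipschitzOnWith_of_nnnorm_fderiv_le hA.differentiableAt hA.norm_fderiv_le

theorem norm_sub_sub_fderiv_le (hA : IntegrableOnWith A S L K K') (hS : Convex ℝ S) {x z : E}
    (hx : x ∈ S) (hz : z ∈ S) : ‖A z - A x - fderiv ℝ A x (z - x)‖ ≤ K' * ‖z - x‖ ^ 2 := by
  have hseg := hS.segment_subset hx hz
  have hbound : ∀ p ∈ segment ℝ x z, ‖fderiv ℝ A p - fderiv ℝ A x‖ ≤ K' * ‖z - x‖ := fun p hp => by
    rw [← dist_eq_norm (fderiv ℝ A p)]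
    refine (hA.lipschitzOnWith_fderiv.dist_le_mul p (hseg hp) x hx).trans ?_
    rw [dist_eq_norm p]
    gcongr
    simpa using norm_sub_le_of_mem_segment hp
  simpa [sq, mul_assoc] using (convex_segment x z).norm_image_sub_le_of_norm_fderiv_le'
    (fun p hp => hA.differentiableAt p (hseg hp)) hbound (left_mem_segment ℝ x z)
    (right_mem_segment ℝ x z)

theorem norm_apply_le (hA : IntegrableOnWith A S L K K') {x : E} (hx : x ∈ S) (u : W) :
    ‖A x u‖ ≤ L * ‖u‖ :=
  ((A x).le_opNorm u).trans (by gcongr; exact hA.norm_le x hx)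

theorem norm_smul_apply_le (hA : IntegrableOnWith A S L K K') {x : E} (hx : x ∈ S) (u : W) {t : ℝ}
    (ht : t ∈ Icc (0 : ℝ) 1) : ‖t • A x u‖ ≤ L * ‖u‖ := by
  rw [norm_smul, Real.norm_of_nonneg ht.1]
  exact (mul_le_of_le_one_left (norm_nonneg _) ht.2).trans (hA.norm_apply_le hx u)

/-- If `y' = A(y) w`, then `y + t A(y) u` is a solution up to `O(‖u‖²)` of the equation with
parameter `w + u`: by the integrability condition the terms of first order in `u` cancel. -/
theorem norm_variation_defect_le (hA : IntegrableOnWith A S L K K') (hS : Convex ℝ S) {x : E}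
    {t r : ℝ} {u w : W} (ht : t ∈ Icc (0 : ℝ) 1) (hx : x ∈ S) (hxu : x + t • A x u ∈ S)
    (hwu : ‖w + u‖ ≤ r) :
    ‖A x w + (t • fderiv ℝ A x (A x w) u + A x u) - A (x + t • A x u) (w + u)‖ ≤
      (K' * L ^ 2 * r + K * L) * ‖u‖ ^ 2 := by
  set T : W →L[ℝ] E := A (x + t • A x u) - A x - fderiv ℝ A x (t • A x u) with hT
  have htaylor : ‖T‖ ≤ K' * (L * ‖u‖) ^ 2 := by
    have h := hA.norm_sub_sub_fderiv_le hS hx hxu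
    rw [add_sub_cancel_left] at h
    refine h.trans ?_
    gcongr
    exact hA.norm_smul_apply_le hx u ht
  have hsecond : ‖fderiv ℝ A x (t • A x u) u‖ ≤ K * (L * ‖u‖) * ‖u‖ :=
    (ContinuousLinearMap.le_opNorm₂ _ _ _).trans (by
      gcongr
      exacts [hA.norm_fderiv_le x hx, hA.norm_smul_apply_le hx u ht])
  calc _ = ‖-(T (w + u)) - fderiv ℝ A x (t • A x u) u‖ := by
        rw [hA.symm x hx u w, hT]
        simp only [map_add, map_smul, sub_apply, smul_apply]
        congr 1
        abel
    _ ≤ ‖T‖ * ‖w + u‖ + ‖fderiv ℝ A x (t • A x u) u‖ := by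
        refine (norm_sub_le _ _).trans ?_
        rw [norm_neg]
        gcongr
        exact T.le_opNorm _
    _ ≤ K' * (L * ‖u‖) ^ 2 * r + K * (L * ‖u‖) * ‖u‖ := by gcongr
    _ = _ := by ring

end IntegrableOnWith

theorem hasDerivWithinAt_add_smul_clm_apply {A : E → W →L[ℝ] E} {y : ℝ → E} {s : Set ℝ} {t : ℝ}
    {u w : W} (hA : DifferentiableAt ℝ A (y t)) (hy : HasDerivWithinAt y (A (y t) w) s t) :
    HasDerivWithinAt (fun τ => y τ + τ • A (y τ) u)
      (A (y t) w + (t • fderiv ℝ A (y t) (A (y t) w) u + A (y t) u)) s t := by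
  have hAy : HasDerivWithinAt (fun τ => A (y τ) u) (fderiv ℝ A (y t) (A (y t) w) u) s t := by
    simpa using (hA.hasFDerivAt.comp_hasDerivWithinAt t hy).clm_apply (hasDerivWithinAt_const t s u)
  simpa using hy.fun_add ((hasDerivWithinAt_id t s).fun_smul hAy)

theorem gronwallBound_zero_left_eq_mul (K ε x : ℝ) :
    gronwallBound 0 K ε x = ε * gronwallBound 0 K 1 x := by
  unfold gronwallBound
  split_ifs <;> ring

theorem IsRaySolution.norm_sub_sub_le {A : E → W →L[ℝ] E} {x₀ : E} {a L K K' r : ℝ≥0} {u w : W}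
    {y z : ℝ → E} (hA : IntegrableOnWith A (closedBall x₀ (2 * a)) L K K')
    (hy : IsRaySolution A x₀ w y) (hz : IsRaySolution A x₀ (w + u) z)
    (hw : L * ‖w‖ < a) (hu : L * ‖u‖ ≤ a) (hwu : L * ‖w + u‖ < a) (hr : ‖w + u‖ ≤ r) :
    ‖z 1 - y 1 - A (y 1) u‖ ≤
      (K' * L ^ 2 * r + K * L) * gronwallBound 0 (K * r) 1 1 * ‖u‖ ^ 2 := by
  set S := closedBall x₀ (2 * a : ℝ) with hS
  have hSconv : Convex ℝ S := convex_closedBall _ _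
  have hball : closedBall x₀ (a : ℝ) ⊆ S :=
    closedBall_subset_closedBall (by linarith [a.coe_nonneg])
  have hy_ball := hy.mem_closedBall a.coe_nonneg (fun x hx => hA.norm_le x (hball hx)) hw
  have hz_ball := hz.mem_closedBall a.coe_nonneg (fun x hx => hA.norm_le x (hball hx)) hwu
  have hyS : ∀ t ∈ Icc (0 : ℝ) 1, y t ∈ S := fun t ht => hball (hy_ball t ht)
  set g : ℝ → E := fun t => y t + t • A (y t) u with hg
  have hgS : ∀ t ∈ Icc (0 : ℝ) 1, g t ∈ S := fun t ht => by
    have h₁ := mem_closedBall_iff_norm.1 (hy_ball t ht)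
    have h₂ := hA.norm_smul_apply_le (hyS t ht) u ht
    rw [hS, mem_closedBall_iff_norm, hg, add_sub_right_comm]
    linarith [norm_add_le (y t - x₀) (t • A (y t) u)]
  have hg' : ∀ t ∈ Icc (0 : ℝ) 1, HasDerivWithinAt g
      (A (y t) w + (t • fderiv ℝ A (y t) (A (y t) w) u + A (y t) u)) (Icc 0 1) t := fun t ht =>
    hasDerivWithinAt_add_smul_clm_apply (hA.differentiableAt _ (hyS t ht))
      (hy.hasDerivWithinAt t ht)
  have hgronwall := dist_le_of_approx_trajectories_ODE_of_mem (a := 0) (b := 1) (δ := 0) (εf := 0)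
    (v := fun _ x => A x (w + u)) (s := fun _ => S)
    (fun _ _ => lipschitzOnWith_clm_apply (hA.lipschitzOnWith hSconv) hr)
    hz.continuousOn (fun _ => hz.hasDerivWithinAt_Ici) (fun t _ => (dist_self _).le)
    (fun t ht => hball (hz_ball t ⟨ht.1, ht.2.le⟩))
    (fun t ht => (hg' t ht).continuousWithinAt)
    (fun t ht => (hg' t ⟨ht.1, ht.2.le⟩).mono_of_mem_nhdsWithin (Icc_mem_nhdsGE_of_mem ht))
    (fun t ht => (dist_eq_norm _ _).trans_le <| hA.norm_variation_defect_le hSconv ⟨ht.1, ht.2.le⟩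
      (hyS t ⟨ht.1, ht.2.le⟩) (hgS t ⟨ht.1, ht.2.le⟩) hr)
    (fun t ht => hgS t ⟨ht.1, ht.2.le⟩) (by simp [hg, hy.map_zero, hz.map_zero]) 1 (by simp)
  rw [dist_eq_norm, gronwallBound_zero_left_eq_mul] at hgronwall
  simpa [hg, sub_sub, mul_right_comm] using hgronwall

theorem hasFDerivAt_of_norm_sub_sub_le_sq {f : W → E} {f' : W →L[ℝ] E} {w : W} {C : ℝ}
    (h : ∀ᶠ u in 𝓝 0, ‖f (w + u) - f w - f' u‖ ≤ C * ‖u‖ ^ 2) : HasFDerivAt f f' w := by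
  rw [hasFDerivAt_iff_isLittleO_nhds_zero]
  refine (Asymptotics.IsBigO.of_bound C (g := fun u : W => ‖u‖ ^ 2) ?_).trans_isLittleO
    (Asymptotics.isLittleO_norm_pow_id one_lt_two)
  simpa using h

/-- **Frobenius' theorem** for total differential equations. The solution is assembled from the
solutions along the rays through `0`. -/
theorem exists_total_solution [CompleteSpace E] {A : E → W →L[ℝ] E} {x₀ : E}
    (hA : ContDiffAt ℝ 2 A x₀)
    (hsymm : ∀ᶠ y in 𝓝 x₀, ∀ u w, fderiv ℝ A y (A y w) u = fderiv ℝ A y (A y u) w) :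
    ∃ r > 0, ∃ ψ : W → E, ψ 0 = x₀ ∧ ∀ w ∈ ball (0 : W) r, HasFDerivAt ψ (A (ψ w)) w := by
  obtain ⟨a, ha, L, K, K', hL, hAS⟩ := exists_integrableOnWith_closedBall hA hsymm
  have hball : closedBall x₀ (a : ℝ) ⊆ closedBall x₀ (2 * a : ℝ) :=
    closedBall_subset_closedBall (by linarith [a.coe_nonneg])
  have hAa := hAS.mono hball
  set r : ℝ≥0 := a / L with hr
  have hLr : ∀ {w : W}, ‖w‖ < r → L * ‖w‖ < a := fun h =>
    (lt_div_iff₀' (NNReal.coe_pos.2 hL)).1 (by simpa [hr] using h)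
  have hray : ∀ w ∈ ball (0 : W) r, ∃ y, IsRaySolution A x₀ w y := fun w hw =>
    exists_isRaySolution (hAa.lipschitzOnWith (convex_closedBall _ _)) hAa.norm_le
      (hLr (mem_ball_zero_iff.1 hw)).le
  choose! y hy using hray
  have hrpos : (0 : ℝ) < r := NNReal.coe_pos.2 (div_pos ha hL)
  refine ⟨r, hrpos, fun w => y w 1, (hy 0 (mem_ball_self hrpos)).apply_one_of_zero,
    fun w hw => ?_⟩
  refine hasFDerivAt_of_norm_sub_sub_le_sq
    (C := (K' * L ^ 2 * r + K * L) * gronwallBound 0 (K * r) 1 1) ?_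
  have hwu : ∀ᶠ u : W in 𝓝 0, w + u ∈ ball (0 : W) r :=
    (continuous_const_add w).tendsto' 0 w (add_zero w) (isOpen_ball.mem_nhds hw)
  filter_upwards [hwu, ball_mem_nhds (0 : W) hrpos] with u hwu hu
  rw [mem_ball_zero_iff] at hu
  have hwu' := mem_ball_zero_iff.1 hwu
  exact (hy w hw).norm_sub_sub_le hAS (hy _ hwu) (hLr (mem_ball_zero_iff.1 hw)) (hLr hu).le
    (hLr hwu') hwu'.le

/-- The two solutions are compared along the segments that start at `w₀`. -/
theorem eventuallyEq_of_total_solution {A : E → W →L[ℝ] E} {ψ₁ ψ₂ : W → E} {w₀ : W}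
    (hA : ContDiffAt ℝ 1 A (ψ₁ w₀)) (h₁ : ∀ᶠ w in 𝓝 w₀, HasFDerivAt ψ₁ (A (ψ₁ w)) w)
    (h₂ : ∀ᶠ w in 𝓝 w₀, HasFDerivAt ψ₂ (A (ψ₂ w)) w) (h : ψ₁ w₀ = ψ₂ w₀) :
    ψ₁ =ᶠ[𝓝 w₀] ψ₂ := by
  obtain ⟨K, s, hs, hK⟩ := hA.exists_lipschitzOnWith
  have hs₁ : ∀ᶠ w in 𝓝 w₀, ψ₁ w ∈ s := h₁.self_of_nhds.continuousAt hs
  have hs₂ : ∀ᶠ w in 𝓝 w₀, ψ₂ w ∈ s := h₂.self_of_nhds.continuousAt (h ▸ hs)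
  obtain ⟨δ, hδ, hball⟩ := Metric.mem_nhds_iff.1 ((h₁.and hs₁).and (h₂.and hs₂))
  filter_upwards [ball_mem_nhds w₀ hδ] with w hw
  have hseg : ∀ t ∈ Icc (0 : ℝ) 1, AffineMap.lineMap w₀ w t ∈ ball w₀ δ := fun t ht =>
    (convex_ball w₀ δ).lineMap_mem (mem_ball_self hδ) hw ht
  have hderiv : ∀ {ψ : W → E} {t : ℝ}, HasFDerivAt ψ (A (ψ (AffineMap.lineMap w₀ w t)))
      (AffineMap.lineMap w₀ w t) → HasDerivAt (fun t => ψ (AffineMap.lineMap w₀ w t))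
        (A (ψ (AffineMap.lineMap w₀ w t)) (w - w₀)) t := fun hψ =>
    hψ.comp_hasDerivAt _ AffineMap.hasDerivAt_lineMap
  have heq := ODE_solution_unique_of_mem_Icc_right (a := 0) (b := 1) (s := fun _ => s)
    (v := fun _ p => A p (w - w₀))
    (f := fun t => ψ₁ (AffineMap.lineMap w₀ w t)) (g := fun t => ψ₂ (AffineMap.lineMap w₀ w t))
    (fun _ _ => lipschitzOnWith_clm_apply hK (le_refl ‖w - w₀‖₊))
    (fun t ht => (hderiv (hball (hseg t ht)).1.1).continuousAt.continuousWithinAt)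
    (fun t ht => (hderiv (hball (hseg t ⟨ht.1, ht.2.le⟩)).1.1).hasDerivWithinAt)
    (fun t ht => (hball (hseg t ⟨ht.1, ht.2.le⟩)).1.2)
    (fun t ht => (hderiv (hball (hseg t ht)).2.1).continuousAt.continuousWithinAt)
    (fun t ht => (hderiv (hball (hseg t ⟨ht.1, ht.2.le⟩)).2.1).hasDerivWithinAt)
    (fun t ht => (hball (hseg t ⟨ht.1, ht.2.le⟩)).2.2) (by simpa using h)
  simpa using heq (x := 1) (by simp)

theorem eventuallyEq_total_solution_comp {A : E → W →L[ℝ] E} {ψ : W → E} {y : ℝ → E} {q c : ℝ → W}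
    {t₀ : ℝ} (hA : ContDiffAt ℝ 1 A (y t₀)) (hy : ∀ᶠ t in 𝓝 t₀, HasDerivAt y (A (y t) (c t)) t)
    (hq : ∀ᶠ t in 𝓝 t₀, HasDerivAt q (c t) t) (hc : ContinuousAt c t₀)
    (hψ : ∀ᶠ w in 𝓝 (q t₀), HasFDerivAt ψ (A (ψ w)) w) (h : y t₀ = ψ (q t₀)) :
    y =ᶠ[𝓝 t₀] ψ ∘ q := by
  obtain ⟨K, s, hs, hK⟩ := hA.exists_lipschitzOnWith
  have hc_lt : ∀ᶠ t in 𝓝 t₀, ‖c t‖ < ‖c t₀‖ + 1 :=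
    hc.norm.eventually_lt_const (lt_add_one _)
  have hq_cont : ContinuousAt q t₀ := hq.self_of_nhds.continuousAt
  have hψq_cont : ContinuousAt (ψ ∘ q) t₀ := hψ.self_of_nhds.continuousAt.comp hq_cont
  refine ODE_solution_unique_of_eventually (K := K * (‖c t₀‖₊ + 1)) (v := fun t p => A p (c t))
    (s := fun _ => s) ?_ ?_ ?_ h
  · filter_upwards [hc_lt] with t ht
    exact lipschitzOnWith_clm_apply hK (by simpa using ht.le)
  · exact hy.and (hy.self_of_nhds.continuousAt hs)
  · filter_upwards [hq_cont.eventually hψ, hq, hψq_cont (h.symm ▸ hs : s ∈ 𝓝 (ψ (q t₀)))]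
      with t hψt hqt hmem using ⟨hψt.comp_hasDerivAt t hqt, hmem⟩

end TotalDifferentialEquations

section FormsOnVectorSpaces

variable {E : Type*} [NormedAddCommGroup E] [NormedSpace ℝ E]
  {F : Type*} [NormedAddCommGroup F] [NormedSpace ℝ F]
  {G : Type*} [NormedAddCommGroup G] [NormedSpace ℝ G]
  {W : Type*} [NormedAddCommGroup W] [NormedSpace ℝ W] {n : ℕ} {x : E} {m : WithTop ℕ∞}

theorem two_le_infty : (2 : WithTop ℕ∞) ≤ ∞ :=
  WithTop.coe_le_coe.2 le_top

theorem contDiffAt_extDeriv {Ω : E → E [⋀^Fin n]→L[ℝ] W} {r : WithTop ℕ∞} (h : ContDiffAt ℝ r Ω x)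
    (hm : m + 1 ≤ r) : ContDiffAt ℝ m (extDeriv Ω) x :=
  ContDiffAt.comp (g := ContinuousAlternatingMap.alternatizeUncurryFinCLM ℝ E W (n := n)) x
    (ContinuousLinearMap.contDiff _).contDiffAt (h.fderiv_right hm)

/-- The identification of one-forms with continuous linear maps. -/
def oneFormCLM : (E [⋀^Fin 1]→L[ℝ] W) →L[ℝ] E →L[ℝ] W :=
  (ContinuousAlternatingMap.ofSubsingletonLIE (𝕜 := ℝ) (E := E) (F := W)
    (0 : Fin 1)).symm.toContinuousLinearEquiv.toContinuousLinearMap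

theorem oneFormCLM_apply (f : E [⋀^Fin 1]→L[ℝ] W) (v : E) : oneFormCLM f v = f ![v] := by
  have hf : f = ContinuousAlternatingMap.ofSubsingletonLIE (𝕜 := ℝ) (0 : Fin 1) (oneFormCLM f) := by
    simp [oneFormCLM]
  conv_rhs => rw [hf]
  rfl

/-- Two-forms as continuous bilinear maps. -/
def twoFormCLM : (E [⋀^Fin 2]→L[ℝ] W) →L[ℝ] E →L[ℝ] E →L[ℝ] W :=
  (ContinuousLinearMap.compL ℝ E (E [⋀^Fin 1]→L[ℝ] W) (E →L[ℝ] W) oneFormCLM).comp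
    (ContinuousAlternatingMap.curryLeftLI (n := 1)).toContinuousLinearMap

theorem twoFormCLM_apply (f : E [⋀^Fin 2]→L[ℝ] W) (v w : E) : twoFormCLM f v w = f ![v, w] :=
  oneFormCLM_apply (f.curryLeft v) w

theorem two_form_swap (f : E [⋀^Fin 2]→L[ℝ] W) (v w : E) : f ![v, w] = -f ![w, v] := by
  have hswap : (![w, v] : Fin 2 → E) ∘ Equiv.swap 0 1 = ![v, w] := by
    ext i
    fin_cases i <;> rfl
  exact hswap ▸ f.toAlternatingMap.map_swap ![w, v] (i := 0) (j := 1) (by simp)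

theorem extDeriv_one_form_apply {α : E → E [⋀^Fin 1]→L[ℝ] W} {Y Z : E → E}
    (hα : DifferentiableAt ℝ α x) (hY : DifferentiableAt ℝ Y x) (hZ : DifferentiableAt ℝ Z x) :
    extDeriv α x ![Y x, Z x] = fderiv ℝ (fun y => α y ![Z y]) x (Y x)
      - fderiv ℝ (fun y => α y ![Y y]) x (Z x) - α x ![VectorField.lieBracket ℝ Y Z x] := by
  have h := extDeriv_apply_vectorField (V := ![Y, Z]) hα (by simp [Fin.forall_fin_two, hY, hZ])
  have hvec : ∀ y, (![Y, Z] · y) = ![Y y, Z y] := fun y => by ext i; fin_cases i <;> rfl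
  have hremove : ∀ a b : E, Fin.removeNth (1 : Fin (0 + 2)) ![a, b] = ![a] := fun a b => by
    ext i; fin_cases i; rfl
  simp only [hvec] at h
  simpa [hremove, Finset.sum_filter, sub_eq_add_neg] using h

theorem extDeriv_two_form_apply {β : E → E [⋀^Fin 2]→L[ℝ] W} {X Y Z : E → E}
    (hβ : DifferentiableAt ℝ β x) (hX : DifferentiableAt ℝ X x) (hY : DifferentiableAt ℝ Y x)
    (hZ : DifferentiableAt ℝ Z x) :
    extDeriv β x ![X x, Y x, Z x] = fderiv ℝ (fun y => β y ![Y y, Z y]) x (X x)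
      - fderiv ℝ (fun y => β y ![X y, Z y]) x (Y x) + fderiv ℝ (fun y => β y ![X y, Y y]) x (Z x)
      - (β x ![VectorField.lieBracket ℝ X Y x, Z x] - β x ![VectorField.lieBracket ℝ X Z x, Y x]
        + β x ![VectorField.lieBracket ℝ Y Z x, X x]) := by
  have h := extDeriv_apply_vectorField (V := ![X, Y, Z]) hβ
    (by simp [Fin.forall_fin_succ, hX, hY, hZ])
  have hvec : ∀ y, (![X, Y, Z] · y) = ![X y, Y y, Z y] := fun y => by
    ext i; fin_cases i <;> rfl
  have hremove₁ : ∀ a b c : E, Fin.removeNth (1 : Fin (1 + 2)) ![a, b, c] = ![a, c] :=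
    fun a b c => by ext i; fin_cases i <;> rfl
  have hremove₂ : ∀ a b c : E, Fin.removeNth (2 : Fin (1 + 2)) ![a, b, c] = ![a, b] :=
    fun a b c => by ext i; fin_cases i <;> rfl
  have hremove₁' : ∀ a b : E, Fin.removeNth (1 : Fin (1 + 1)) ![a, b] = ![a] := fun a b => by
    ext i; fin_cases i; rfl
  have hIci : Finset.Ici (1 : Fin (1 + 1)) = {1} := rfl
  simp only [hvec] at h
  simpa [Fin.sum_univ_succ, hIci, hremove₁, hremove₂, hremove₁', sub_eq_add_neg, add_assoc]
    using h

/-- The Reeb fields of `α` commute, because a vector field `R` with `ι_R dα = 0` and `ι_R α`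
constant is determined by that constant. -/
theorem lieBracket_eq_zero_of_reeb {α : E → E [⋀^Fin 1]→L[ℝ] W} {Y Z : E → E} {u w : W}
    (hα : ContDiffAt ℝ 2 α x) (hY : DifferentiableAt ℝ Y x) (hZ : DifferentiableAt ℝ Z x)
    (hαY : ∀ᶠ y in 𝓝 x, α y ![Y y] = u) (hαZ : ∀ᶠ y in 𝓝 x, α y ![Z y] = w)
    (hdαY : ∀ᶠ y in 𝓝 x, ∀ v, extDeriv α y ![Y y, v] = 0)
    (hdαZ : ∀ᶠ y in 𝓝 x, ∀ v, extDeriv α y ![Z y, v] = 0)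
    (hinj : ∀ v, α x ![v] = 0 → (∀ v', extDeriv α x ![v, v'] = 0) → v = 0) :
    VectorField.lieBracket ℝ Y Z x = 0 := by
  have hfderiv : ∀ {f : E → W} {c : W}, (∀ᶠ y in 𝓝 x, f y = c) → fderiv ℝ f x = 0 :=
    fun hf => (EventuallyEq.fderiv_eq hf).trans (by simp)
  have hdα : DifferentiableAt ℝ (extDeriv α) x :=
    (contDiffAt_extDeriv (m := 1) hα (by norm_num)).differentiableAt (by simp)
  refine hinj _ ?_ fun v => ?_
  · have h := extDeriv_one_form_apply (hα.differentiableAt (by simp)) hY hZ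
    rw [hdαY.self_of_nhds, hfderiv hαY, hfderiv hαZ] at h
    simpa using h.symm
  · have h := extDeriv_two_form_apply hdα hY hZ (differentiableAt_const v)
    rw [extDeriv_extDeriv_apply hα (by simp), hfderiv (hdαY.mono fun y hy => hy _),
      hfderiv (hdαZ.mono fun y hy => hy _), hfderiv (hdαY.mono fun y hy => hy _),
      two_form_swap _ _ (Z x), two_form_swap _ _ (Y x), hdαY.self_of_nhds,
      hdαZ.self_of_nhds] at h
    simpa using h

theorem fderiv_symm_of_reeb {α : E → E [⋀^Fin 1]→L[ℝ] W} {A : E → W →L[ℝ] E}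
    (hα : ContDiffAt ℝ 2 α x) (hA : DifferentiableAt ℝ A x)
    (hαA : ∀ᶠ y in 𝓝 x, ∀ w, α y ![A y w] = w)
    (hdαA : ∀ᶠ y in 𝓝 x, ∀ w v, extDeriv α y ![A y w, v] = 0)
    (hinj : ∀ v, α x ![v] = 0 → (∀ v', extDeriv α x ![v, v'] = 0) → v = 0) (u w : W) :
    fderiv ℝ A x (A x w) u = fderiv ℝ A x (A x u) w := by
  have hA' : ∀ w, HasFDerivAt (fun y => A y w) ((fderiv ℝ A x).flip w) x := fun w => by
    simpa using hA.hasFDerivAt.clm_apply (hasFDerivAt_const w x)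
  have hbracket := lieBracket_eq_zero_of_reeb hα (hA' w).differentiableAt (hA' u).differentiableAt
    (hαA.mono fun y hy => hy w) (hαA.mono fun y hy => hy u) (hdαA.mono fun y hy => hy w)
    (hdαA.mono fun y hy => hy u) hinj
  rwa [VectorField.lieBracket, (hA' w).fderiv, (hA' u).fderiv, sub_eq_zero] at hbracket

theorem contDiffAt_of_clm_apply_eq [CompleteSpace F] {T : E → F →L[ℝ] G} {r : E → F} {c : G}
    (hT : ContDiffAt ℝ m T x) (hinv : (T x).HasLeftInverse) (hr : ∀ᶠ y in 𝓝 x, T y (r y) = c) :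
    ContDiffAt ℝ m r x := by
  obtain ⟨L, hL⟩ := hinv
  have hLT : ContDiffAt ℝ m (fun y => L.comp (T y)) x := contDiffAt_const.clm_comp hT
  have hLTx : L.comp (T x) = ContinuousLinearEquiv.refl ℝ F := by
    ext v
    exact hL v
  have hLT_inv : ContDiffAt ℝ m (fun y => (L.comp (T y)).inverse (L c)) x :=
    ((ContinuousLinearMap.IsInvertible.contDiffAt_map_inverse ⟨_, hLTx.symm⟩).comp x hLT).clm_apply
      contDiffAt_const
  have hinvertible : ∀ᶠ y in 𝓝 x, (L.comp (T y)).IsInvertible :=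
    hLT.continuousAt (hLTx ▸ ContinuousLinearEquiv.nhds _)
  refine hLT_inv.congr_of_eventuallyEq ?_
  filter_upwards [hinvertible, hr] with y ⟨e, he⟩ hy
  have hey : e (r y) = L c := by
    rw [← hy, ← e.coe_coe, he]
    rfl
  rw [← he, ContinuousLinearMap.inverse_equiv, ← hey]
  simp

theorem contDiffAt_of_one_form_two_form_apply_eq [FiniteDimensional ℝ E] [FiniteDimensional ℝ W]
    {α : E → E [⋀^Fin 1]→L[ℝ] W} {β : E → E [⋀^Fin 2]→L[ℝ] W} {r : E → E} {w : W}
    (hα : ContDiffAt ℝ m α x) (hβ : ContDiffAt ℝ m β x)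
    (hinj : ∀ v, α x ![v] = 0 → (∀ v', β x ![v, v'] = 0) → v = 0)
    (hαr : ∀ᶠ y in 𝓝 x, α y ![r y] = w) (hβr : ∀ᶠ y in 𝓝 x, ∀ v, β y ![r y, v] = 0) :
    ContDiffAt ℝ m r x := by
  let T : E → E →L[ℝ] W × (E →L[ℝ] W) := fun y => (oneFormCLM (α y)).prod (twoFormCLM (β y))
  have hα' : ContDiffAt ℝ m (fun y => oneFormCLM (α y)) x :=
    ContDiffAt.comp (g := oneFormCLM) x (ContinuousLinearMap.contDiff _).contDiffAt hα
  have hβ' : ContDiffAt ℝ m (fun y => twoFormCLM (β y)) x :=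
    ContDiffAt.comp (g := twoFormCLM) x (ContinuousLinearMap.contDiff _).contDiffAt hβ
  have hT : ContDiffAt ℝ m T x :=
    ContDiffAt.comp (g := (ContinuousLinearMap.prodₗᵢ ℝ :
        (E →L[ℝ] W) × (E →L[ℝ] E →L[ℝ] W) ≃ₗᵢ[ℝ] E →L[ℝ] W × (E →L[ℝ] W))) x
      (LinearIsometryEquiv.contDiff _).contDiffAt (hα'.prodMk hβ')
  refine contDiffAt_of_clm_apply_eq (c := (w, 0)) hT
    (.of_injective_of_finiteDimensional <| (injective_iff_map_eq_zero _).2 fun v hv => ?_) ?_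
  · obtain ⟨hαv, hβv⟩ := Prod.mk_eq_zero.1 hv
    refine hinj v ((oneFormCLM_apply _ _).symm.trans hαv) fun v' => ?_
    rw [← twoFormCLM_apply]
    exact DFunLike.congr_fun hβv v'
  · filter_upwards [hαr, hβr] with y hαy hβy
    refine Prod.ext ((oneFormCLM_apply _ _).trans hαy) (ContinuousLinearMap.ext fun v => ?_)
    exact (twoFormCLM_apply _ _ _).trans (hβy v)

theorem norm_alternatization_le (f : ContinuousMultilinearMap ℝ (fun _ : Fin n => E) W) :
    ‖ContinuousMultilinearMap.alternatization f‖ ≤ Fintype.card (Equiv.Perm (Fin n)) * ‖f‖ := by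
  refine ContinuousAlternatingMap.opNorm_le_bound _ (by positivity) fun v => ?_
  have hterm : ∀ σ : Equiv.Perm (Fin n),
      ‖Equiv.Perm.sign σ • f (v ∘ σ)‖ ≤ ‖f‖ * ∏ i, ‖v i‖ := fun σ => by
    have hnorm : ‖Equiv.Perm.sign σ • f (v ∘ σ)‖ = ‖f (v ∘ σ)‖ := by
      rcases Int.units_eq_one_or (Equiv.Perm.sign σ) with h | h <;> simp [h]
    rw [hnorm, ← Equiv.prod_comp σ fun i => ‖v i‖]
    exact f.le_opNorm _
  rw [ContinuousMultilinearMap.alternatization_apply_apply]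
  refine (norm_sum_le_of_le _ fun σ _ => hterm σ).trans_eq ?_
  simp [Finset.card_univ, mul_assoc]

/-- Alternatization of continuous multilinear maps, as a continuous linear map. -/
def alternatizationCLM :
    ContinuousMultilinearMap ℝ (fun _ : Fin n => E) W →L[ℝ] E [⋀^Fin n]→L[ℝ] W :=
  LinearMap.mkContinuous
    { toFun := ContinuousMultilinearMap.alternatization
      map_add' := map_add _
      map_smul' := fun c f => by
        ext v
        simp [ContinuousMultilinearMap.alternatization_apply_apply, Finset.smul_sum,
          smul_comm c] }
    (Fintype.card (Equiv.Perm (Fin n))) norm_alternatization_le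

theorem alternatizationCLM_toContinuousMultilinearMap (f : E [⋀^Fin n]→L[ℝ] W) :
    alternatizationCLM f.toContinuousMultilinearMap =
      (Fintype.card (Equiv.Perm (Fin n)) : ℝ) • f := by
  ext v
  have hterm : ∀ σ : Equiv.Perm (Fin n), Equiv.Perm.sign σ • f (v ∘ σ) = f v := fun σ => by
    refine (congrArg _ (f.toAlternatingMap.map_perm v σ)).trans ?_
    rw [smul_smul, Int.units_mul_self, one_smul]
    rfl
  refine (ContinuousMultilinearMap.alternatization_apply_apply _ v).trans ?_
  simp [hterm, Finset.card_univ, ← Nat.cast_smul_eq_nsmul ℝ]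

theorem contDiffAt_compContinuousLinearMap {Ω : G → F [⋀^Fin n]→L[ℝ] W} {g : G → E →L[ℝ] F}
    {x : G} (hΩ : ContDiffAt ℝ m Ω x) (hg : ContDiffAt ℝ m g x) :
    ContDiffAt ℝ m (fun y => (Ω y).compContinuousLinearMap (g y)) x := by
  have hcomp : ∀ y, (Ω y).compContinuousLinearMap (g y) =
      (Fintype.card (Equiv.Perm (Fin n)) : ℝ)⁻¹ • alternatizationCLM
        (ContinuousMultilinearMap.compContinuousLinearMapContinuousMultilinear ℝ
          (fun _ : Fin n => E) (fun _ : Fin n => F) W (fun _ => g y)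
          (ContinuousAlternatingMap.toContinuousMultilinearMapCLM ℝ (Ω y))) := fun y => by
    rw [eq_inv_smul_iff₀ (by simp [Fintype.card_ne_zero]),
      ← alternatizationCLM_toContinuousMultilinearMap]
    rfl
  simp_rw [hcomp]
  refine ContDiffAt.const_smul _ (ContDiffAt.comp (g := alternatizationCLM) x
    (ContinuousLinearMap.contDiff _).contDiffAt (ContDiffAt.clm_apply ?_
      ((ContinuousLinearMap.contDiff _).contDiffAt.comp x hΩ)))
  exact (ContinuousMultilinearMap.contDiff _).contDiffAt.comp x (contDiffAt_pi.2 fun _ => hg)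

end FormsOnVectorSpaces

section Differential

variable (E : Type*) [NormedAddCommGroup E] [NormedSpace ℝ E]
  {M : Type*} [TopologicalSpace M] [ChartedSpace E M]
  (E' : Type*) [NormedAddCommGroup E'] [NormedSpace ℝ E']
  {N : Type*} [TopologicalSpace N] [ChartedSpace E' N]
  {E'' : Type*} [NormedAddCommGroup E''] [NormedSpace ℝ E'']
  {P : Type*} [TopologicalSpace P] [ChartedSpace E'' P]

/-- The differential of a map between manifolds, with all tangent spaces identified with the model
spaces. Its type does not depend on the point, so that one may rewrite with equalities of
points. -/
def mfd (f : M → N) (x : M) : E →L[ℝ] E' := mfderiv 𝓘(ℝ, E) 𝓘(ℝ, E') f x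

variable {E E'}

theorem mfd_comp {g : N → P} {f : M → N} {x : M}
    (hg : MDifferentiableAt 𝓘(ℝ, E') 𝓘(ℝ, E'') g (f x))
    (hf : MDifferentiableAt 𝓘(ℝ, E) 𝓘(ℝ, E') f x) :
    mfd E E'' (fun z => g (f z)) x = (mfd E' E'' g (f x)).comp (mfd E E' f x) :=
  mfderiv_comp x hg hf

theorem mfd_comp_apply {g : N → P} {f : M → N} {x : M}
    (hg : MDifferentiableAt 𝓘(ℝ, E') 𝓘(ℝ, E'') g (f x))
    (hf : MDifferentiableAt 𝓘(ℝ, E) 𝓘(ℝ, E') f x) (v : E) :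
    mfd E E'' (fun z => g (f z)) x v = mfd E' E'' g (f x) (mfd E E' f x v) := by
  rw [mfd_comp hg hf]
  rfl

theorem mfd_eq_fderiv {f : E → E'} {x : E} : mfd E E' f x = fderiv ℝ f x :=
  mfderiv_eq_fderiv

theorem mfd_congr {f g : M → N} {x : M} (h : f =ᶠ[𝓝 x] g) : mfd E E' f x = mfd E E' g x :=
  h.mfderiv_eq

theorem mfd_id {x : M} : mfd E E (fun z : M => z) x = ContinuousLinearMap.id ℝ E :=
  mfderiv_id

end Differential

section Charts

variable {E : Type*} [NormedAddCommGroup E] [NormedSpace ℝ E]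
  {M : Type*} [TopologicalSpace M] [ChartedSpace E M] [IsManifold 𝓘(ℝ, E) ∞ M] {x₀ x : M} {y : E}

theorem contMDiffAt_extChartAt_symm (hy : y ∈ (extChartAt 𝓘(ℝ, E) x₀).target) :
    ContMDiffAt 𝓘(ℝ, E) 𝓘(ℝ, E) ∞ (extChartAt 𝓘(ℝ, E) x₀).symm y :=
  (contMDiffOn_extChartAt_symm x₀).contMDiffAt ((isOpen_extChartAt_target x₀).mem_nhds hy)

theorem contMDiffAt_extChartAt_of_mem_source (hx : x ∈ (extChartAt 𝓘(ℝ, E) x₀).source) :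
    ContMDiffAt 𝓘(ℝ, E) 𝓘(ℝ, E) ∞ (extChartAt 𝓘(ℝ, E) x₀) x :=
  contMDiffAt_extChartAt' (by simpa using hx)

theorem isInvertible_mfd_extChartAt_symm (hy : y ∈ (extChartAt 𝓘(ℝ, E) x₀).target) :
    (mfd E E (extChartAt 𝓘(ℝ, E) x₀).symm y).IsInvertible := by
  have h := isInvertible_mfderivWithin_extChartAt_symm (I := 𝓘(ℝ, E)) hy
  rwa [modelWithCornersSelf_coe, range_id, mfderivWithin_univ] at h

theorem mfd_extChartAt_mfd_symm (hy : y ∈ (extChartAt 𝓘(ℝ, E) x₀).target) (v : E) :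
    mfd E E (extChartAt 𝓘(ℝ, E) x₀) ((extChartAt 𝓘(ℝ, E) x₀).symm y)
      (mfd E E (extChartAt 𝓘(ℝ, E) x₀).symm y v) = v := by
  have h := mfderiv_extChartAt_comp_mfderivWithin_extChartAt_symm (I := 𝓘(ℝ, E)) hy
  rw [modelWithCornersSelf_coe, range_id, mfderivWithin_univ] at h
  exact DFunLike.congr_fun h v

theorem mfd_symm_mfd_extChartAt (hx : x ∈ (extChartAt 𝓘(ℝ, E) x₀).source) (v : E) :
    mfd E E (extChartAt 𝓘(ℝ, E) x₀).symm (extChartAt 𝓘(ℝ, E) x₀ x)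
      (mfd E E (extChartAt 𝓘(ℝ, E) x₀) x v) = v := by
  have h := mfderivWithin_extChartAt_symm_comp_mfderiv_extChartAt' (I := 𝓘(ℝ, E)) hx
  rw [modelWithCornersSelf_coe, range_id, mfderivWithin_univ] at h
  exact DFunLike.congr_fun h v

theorem mfd_extChartAt_self (x : M) :
    mfd E E (extChartAt 𝓘(ℝ, E) x) x = ContinuousLinearMap.id ℝ E :=
  mfderiv_extChartAt_self

theorem mfd_extChartAt_symm_self (x : M) :
    mfd E E (extChartAt 𝓘(ℝ, E) x).symm (extChartAt 𝓘(ℝ, E) x x) = ContinuousLinearMap.id ℝ E := by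
  ext v
  have h := mfd_symm_mfd_extChartAt (mem_extChartAt_source (I := 𝓘(ℝ, E)) x) v
  rwa [mfd_extChartAt_self] at h

end Charts

section Forms

variable {E : Type*} [NormedAddCommGroup E] [NormedSpace ℝ E]
  {M : Type*} [TopologicalSpace M] [ChartedSpace E M]
  {E' : Type*} [NormedAddCommGroup E'] [NormedSpace ℝ E']
  {N : Type*} [TopologicalSpace N] [ChartedSpace E' N]
  {E'' : Type*} [NormedAddCommGroup E''] [NormedSpace ℝ E'']
  {P : Type*} [TopologicalSpace P] [ChartedSpace E'' P] {n k : ℕ}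

/-- The value of a form at a point, with the tangent space identified with the model space. -/
def formAt (Ω : DForm E M n k) (x : M) : E [⋀^Fin n]→L[ℝ] (Fin k → ℝ) := Ω x

theorem formAt_pullbackForm (f : M → N) (Ω : DForm E' N n k) (x : M) :
    formAt (pullbackForm f Ω : DForm E M n k) x =
      (formAt Ω (f x)).compContinuousLinearMap (mfd E E' f x) :=
  rfl

theorem formAt_pullbackForm_one (f : M → N) (Ω : DForm E' N 1 k) (x : M) (v : E) :
    formAt (pullbackForm f Ω : DForm E M 1 k) x ![v] = formAt Ω (f x) ![mfd E E' f x v] := by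
  refine congrArg (formAt Ω (f x)) (funext fun i => ?_)
  fin_cases i
  rfl

theorem formAt_pullbackForm_two (f : M → N) (Ω : DForm E' N 2 k) (x : M) (v w : E) :
    formAt (pullbackForm f Ω : DForm E M 2 k) x ![v, w] =
      formAt Ω (f x) ![mfd E E' f x v, mfd E E' f x w] := by
  refine congrArg (formAt Ω (f x)) (funext fun i => ?_)
  fin_cases i <;> rfl

theorem formAt_pullbackForm_congr {f g : M → N} {x : M} (h : f =ᶠ[𝓝 x] g) (Ω : DForm E' N n k) :
    formAt (pullbackForm f Ω : DForm E M n k) x = formAt (pullbackForm g Ω) x := by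
  rw [formAt_pullbackForm, formAt_pullbackForm, mfd_congr h, h.self_of_nhds]

theorem formAt_pullbackForm_comp {g : N → P} {f : M → N} {x : M}
    (hg : MDifferentiableAt 𝓘(ℝ, E') 𝓘(ℝ, E'') g (f x))
    (hf : MDifferentiableAt 𝓘(ℝ, E) 𝓘(ℝ, E') f x) (Ω : DForm E'' P n k) :
    formAt (pullbackForm (fun z => g (f z)) Ω : DForm E M n k) x =
      (formAt (pullbackForm g Ω : DForm E' N n k) (f x)).compContinuousLinearMap
        (mfd E E' f x) := by
  rw [formAt_pullbackForm, mfd_comp hg hf]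
  rfl

theorem localRep_apply_one (η : DForm E M 1 k) (x₀ : M) (y v : E) :
    localRep η x₀ y ![v] = formAt η ((extChartAt 𝓘(ℝ, E) x₀).symm y)
      ![mfd E E (extChartAt 𝓘(ℝ, E) x₀).symm y v] :=
  formAt_pullbackForm_one (extChartAt 𝓘(ℝ, E) x₀).symm η y v

theorem localRep_apply_two (Ω : DForm E M 2 k) (x₀ : M) (y v w : E) :
    localRep Ω x₀ y ![v, w] = formAt Ω ((extChartAt 𝓘(ℝ, E) x₀).symm y)
      ![mfd E E (extChartAt 𝓘(ℝ, E) x₀).symm y v, mfd E E (extChartAt 𝓘(ℝ, E) x₀).symm y w] :=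
  formAt_pullbackForm_two (extChartAt 𝓘(ℝ, E) x₀).symm Ω y v w

theorem formAt_dExt (Ω : DForm E M n k) (x : M) :
    formAt (dExt Ω) x = (extDeriv (localRep Ω x)
      (extChartAt 𝓘(ℝ, E) x x)).compContinuousLinearMap (mfd E E (extChartAt 𝓘(ℝ, E) x) x) :=
  rfl

theorem mem_kerForm_one {η : DForm E M 1 k} {x : M} {v : E} :
    v ∈ kerForm η x ↔ formAt η x ![v] = 0 :=
  ⟨fun h => h ![], fun h w => Subsingleton.elim ![] w ▸ h⟩

theorem mem_kerForm_two {Ω : DForm E M 2 k} {x : M} {v : E} :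
    v ∈ kerForm Ω x ↔ ∀ w : E, formAt Ω x ![v, w] = 0 := by
  refine ⟨fun h w => h ![w], fun h w => ?_⟩
  have hw : w = ![w 0] := List.ofFn_inj.mp rfl
  exact hw ▸ h (w 0)

theorem IsSmoothForm.contDiffAt_localRep {Ω : DForm E M n k} (hΩ : IsSmoothForm Ω) {x₀ : M} {y : E}
    (hy : y ∈ (extChartAt 𝓘(ℝ, E) x₀).target) : ContDiffAt ℝ ∞ (localRep Ω x₀) y :=
  (hΩ x₀).contDiffAt ((isOpen_extChartAt_target x₀).mem_nhds hy)

variable [IsManifold 𝓘(ℝ, E) ∞ M]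

theorem localRep_self_apply_one (η : DForm E M 1 k) (x : M) (v : E) :
    localRep η x (extChartAt 𝓘(ℝ, E) x x) ![v] = formAt η x ![v] := by
  rw [localRep_apply_one, mfd_extChartAt_symm_self, extChartAt_to_inv]
  rfl

theorem localRep_self_apply_two (Ω : DForm E M 2 k) (x : M) (v w : E) :
    localRep Ω x (extChartAt 𝓘(ℝ, E) x x) ![v, w] = formAt Ω x ![v, w] := by
  rw [localRep_apply_two, mfd_extChartAt_symm_self, extChartAt_to_inv]
  rfl

theorem formAt_pullbackForm_eq_localRep (Ω : DForm E M n k) {f : E' → M} {x₀ : M} {z : E'}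
    (hf : MDifferentiableAt 𝓘(ℝ, E') 𝓘(ℝ, E) f z) (hz : f z ∈ (extChartAt 𝓘(ℝ, E) x₀).source) :
    formAt (pullbackForm f Ω) z =
      (localRep Ω x₀ (extChartAt 𝓘(ℝ, E) x₀ (f z))).compContinuousLinearMap
        (fderiv ℝ (fun z => extChartAt 𝓘(ℝ, E) x₀ (f z)) z) := by
  have hf_eq : f =ᶠ[𝓝 z]
      fun z => (extChartAt 𝓘(ℝ, E) x₀).symm (extChartAt 𝓘(ℝ, E) x₀ (f z)) := by
    filter_upwards [hf.continuousAt ((isOpen_extChartAt_source x₀).mem_nhds hz)] with z' hz'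
    exact ((extChartAt 𝓘(ℝ, E) x₀).left_inv hz').symm
  have hchart : MDifferentiableAt 𝓘(ℝ, E') 𝓘(ℝ, E) (fun z => extChartAt 𝓘(ℝ, E) x₀ (f z)) z :=
    ((contMDiffAt_extChartAt_of_mem_source hz).mdifferentiableAt (by simp)).comp z hf
  rw [formAt_pullbackForm_congr hf_eq, formAt_pullbackForm_comp
    (g := (extChartAt 𝓘(ℝ, E) x₀).symm) (f := fun z => extChartAt 𝓘(ℝ, E) x₀ (f z))
    ((contMDiffAt_extChartAt_symm ((extChartAt 𝓘(ℝ, E) x₀).map_source hz)).mdifferentiableAt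
      (by simp)) hchart, mfd_eq_fderiv]
  rfl

section Pullback

variable {Ω : DForm E M n k} {f : E' → M} {z : E'}

theorem formAt_pullbackForm_eventuallyEq_localRep (hf : ContMDiffAt 𝓘(ℝ, E') 𝓘(ℝ, E) ∞ f z) :
    formAt (pullbackForm f Ω) =ᶠ[𝓝 z] fun z' =>
      (localRep Ω (f z) (extChartAt 𝓘(ℝ, E) (f z) (f z'))).compContinuousLinearMap
        (fderiv ℝ (fun z' => extChartAt 𝓘(ℝ, E) (f z) (f z')) z') := by
  filter_upwards [hf.continuousAt (extChartAt_source_mem_nhds (I := 𝓘(ℝ, E)) (f z)),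
    (contMDiffAt_iff_contMDiffAt_nhds (by simp)).1 (hf.of_le (m := 1) (by simp))] with z' hz' hfz'
  exact formAt_pullbackForm_eq_localRep Ω (hfz'.mdifferentiableAt (by simp)) hz'

theorem contDiffAt_extChartAt_comp (hf : ContMDiffAt 𝓘(ℝ, E') 𝓘(ℝ, E) ∞ f z) :
    ContDiffAt ℝ ∞ (fun z' => extChartAt 𝓘(ℝ, E) (f z) (f z')) z :=
  ((contMDiffAt_extChartAt_of_mem_source (mem_extChartAt_source (f z))).comp z hf).contDiffAt

theorem IsSmoothForm.contDiffAt_pullbackForm (hΩ : IsSmoothForm Ω)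
    (hf : ContMDiffAt 𝓘(ℝ, E') 𝓘(ℝ, E) ∞ f z) :
    ContDiffAt ℝ ∞ (formAt (pullbackForm f Ω : DForm E' E' n k)) z := by
  have hchart := contDiffAt_extChartAt_comp hf
  refine (contDiffAt_compContinuousLinearMap ?_
    (hchart.fderiv_right (by simp))).congr_of_eventuallyEq
      (formAt_pullbackForm_eventuallyEq_localRep hf)
  exact (hΩ.contDiffAt_localRep (mem_extChartAt_target (f z))).comp z hchart

theorem IsSmoothForm.extDeriv_pullbackForm (hΩ : IsSmoothForm Ω)
    (hf : ContMDiffAt 𝓘(ℝ, E') 𝓘(ℝ, E) ∞ f z) :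
    extDeriv (formAt (pullbackForm f Ω : DForm E' E' n k)) z =
      formAt (pullbackForm f (dExt Ω) : DForm E' E' (n + 1) k) z := by
  rw [(formAt_pullbackForm_eventuallyEq_localRep hf).extDeriv_eq,
    extDeriv_pullback (f := fun z' => extChartAt 𝓘(ℝ, E) (f z) (f z'))
      ((hΩ.contDiffAt_localRep (mem_extChartAt_target (f z))).differentiableAt (by simp))
      (contDiffAt_extChartAt_comp hf)
      (by rw [minSmoothness_of_isRCLikeNormedField]; exact two_le_infty),
    ← mfd_eq_fderiv, mfd_comp ((contMDiffAt_extChartAt_of_mem_source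
      (mem_extChartAt_source (f z))).mdifferentiableAt (by simp)) (hf.mdifferentiableAt (by simp)),
    formAt_pullbackForm, formAt_dExt]
  rfl

end Pullback

theorem IsSmoothForm.localRep_dExt {Ω : DForm E M n k} (hΩ : IsSmoothForm Ω) {x₀ : M} {y : E}
    (hy : y ∈ (extChartAt 𝓘(ℝ, E) x₀).target) :
    localRep (dExt Ω) x₀ y = extDeriv (localRep Ω x₀) y :=
  (hΩ.extDeriv_pullbackForm (contMDiffAt_extChartAt_symm hy)).symm

theorem IsSmoothForm.dExt {Ω : DForm E M n k} (hΩ : IsSmoothForm Ω) :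
    IsSmoothForm (KContact.dExt Ω) := fun x₀ =>
  ContDiffOn.congr (f := extDeriv (localRep Ω x₀))
    (fun _ hy => (contDiffAt_extDeriv (hΩ.contDiffAt_localRep hy) (by simp)).contDiffWithinAt)
    fun _ hy => hΩ.localRep_dExt hy

theorem IsSmoothForm.dExt_dExt {Ω : DForm E M n k} (hΩ : IsSmoothForm Ω) :
    KContact.dExt (KContact.dExt Ω) = 0 := by
  funext x
  have hx := mem_extChartAt_target (I := 𝓘(ℝ, E)) x
  have hlocal : localRep (KContact.dExt Ω) x =ᶠ[𝓝 (extChartAt 𝓘(ℝ, E) x x)]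
      extDeriv (localRep Ω x) := by
    filter_upwards [(isOpen_extChartAt_target x).mem_nhds hx] with y hy
    exact hΩ.localRep_dExt hy
  have hzero : extDeriv (localRep (KContact.dExt Ω) x) (extChartAt 𝓘(ℝ, E) x x) = 0 := by
    rw [hlocal.extDeriv_eq]
    exact extDeriv_extDeriv_apply (hΩ.contDiffAt_localRep hx)
      (by rw [minSmoothness_of_isRCLikeNormedField]; exact two_le_infty)
  refine (formAt_dExt _ x).trans ?_
  rw [hzero]
  rfl

end Forms

section VectorFields

variable {E : Type*} [NormedAddCommGroup E] [NormedSpace ℝ E]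
  {M : Type*} [TopologicalSpace M] [ChartedSpace E M]

/-- The value of a vector field at a point, as an element of the model space `E`. -/
def vecAt (Y : VField E M) (x : M) : E := Y x

/-- The coordinate expression of a vector field in the preferred chart at `x₀`. It is meaningful on
the target of the chart. -/
def localRepVF (Y : VField E M) (x₀ : M) (y : E) : E :=
  (mfd E E (extChartAt 𝓘(ℝ, E) x₀).symm y).inverse (vecAt Y ((extChartAt 𝓘(ℝ, E) x₀).symm y))

variable [IsManifold 𝓘(ℝ, E) ∞ M] {x₀ x : M} {y : E}

theorem mfd_extChartAt_symm_localRepVF (Y : VField E M)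
    (hy : y ∈ (extChartAt 𝓘(ℝ, E) x₀).target) :
    mfd E E (extChartAt 𝓘(ℝ, E) x₀).symm y (localRepVF Y x₀ y) =
      vecAt Y ((extChartAt 𝓘(ℝ, E) x₀).symm y) := by
  obtain ⟨e, he⟩ := isInvertible_mfd_extChartAt_symm hy
  rw [localRepVF, ← he, ContinuousLinearMap.inverse_equiv]
  exact e.apply_symm_apply _

theorem mfd_extChartAt_apply_eq_localRepVF (Y : VField E M)
    (hx : x ∈ (extChartAt 𝓘(ℝ, E) x₀).source) :
    mfd E E (extChartAt 𝓘(ℝ, E) x₀) x (vecAt Y x) = localRepVF Y x₀ (extChartAt 𝓘(ℝ, E) x₀ x) := by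
  have hx' := (extChartAt 𝓘(ℝ, E) x₀).map_source hx
  have h := mfd_extChartAt_mfd_symm hx' (localRepVF Y x₀ (extChartAt 𝓘(ℝ, E) x₀ x))
  rwa [mfd_extChartAt_symm_localRepVF Y hx', (extChartAt 𝓘(ℝ, E) x₀).left_inv hx] at h

theorem contMDiffAt_vfield_iff {Y : VField E M} {m : WithTop ℕ∞} :
    ContMDiffAt 𝓘(ℝ, E) 𝓘(ℝ, E).tangent m (fun x => (⟨x, Y x⟩ : TangentBundle 𝓘(ℝ, E) M)) x₀ ↔
      ContMDiffAt 𝓘(ℝ, E) 𝓘(ℝ, E) m (fun x => localRepVF Y x₀ (extChartAt 𝓘(ℝ, E) x₀ x)) x₀ := by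
  refine (Bundle.contMDiffAt_section (IB := 𝓘(ℝ, E)) (F := E)
    (E := fun x : M => TangentSpace 𝓘(ℝ, E) x) (s := Y) x₀).trans
      (Filter.EventuallyEq.contMDiffAt_iff ?_)
  filter_upwards [extChartAt_source_mem_nhds (I := 𝓘(ℝ, E)) x₀] with x hx
  have hx' : x ∈ (chartAt E x₀).source := by simpa using hx
  have hx_base : x ∈ (trivializationAt E (TangentSpace 𝓘(ℝ, E)) x₀).baseSet := by simpa using hx'
  have htriv := TangentBundle.continuousLinearMapAt_trivializationAt (I := 𝓘(ℝ, E)) hx'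
  refine Eq.trans ?_ ((DFunLike.congr_fun htriv (Y x)).trans
    (mfd_extChartAt_apply_eq_localRepVF Y hx))
  exact (congrFun (Bundle.Trivialization.coe_linearMapAt_of_mem (R := ℝ) _ hx_base) (Y x)).symm

theorem IsSmoothVF.contDiffAt_localRepVF [CompleteSpace E] {Y : VField E M} (hY : IsSmoothVF Y)
    (hy : y ∈ (extChartAt 𝓘(ℝ, E) x₀).target) : ContDiffAt ℝ ∞ (localRepVF Y x₀) y := by
  have : IsManifold 𝓘(ℝ, E) (∞ + 1) M := by simpa
  exact contMDiffAt_vectorSpace_iff_contDiffAt.1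
    (ContMDiffAt.mpullback_vectorField_preimage (n := ∞) (hY _) (contMDiffAt_extChartAt_symm hy)
      (isInvertible_mfd_extChartAt_symm (E := E) hy) (by simp))

theorem mlieBracket_eq_lieBracket_localRepVF (Y Z : VField E M) (x : M) :
    VectorField.mlieBracket 𝓘(ℝ, E) Y Z x =
      VectorField.lieBracket ℝ (localRepVF Y x) (localRepVF Z x) (extChartAt 𝓘(ℝ, E) x x) := by
  rw [← VectorField.mlieBracketWithin_univ, VectorField.mlieBracketWithin_apply]
  simp only [modelWithCornersSelf_coe, range_id, preimage_univ, inter_univ,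
    VectorField.mpullbackWithin_univ]
  have hinverse : (mfd E E (extChartAt 𝓘(ℝ, E) x) x).inverse = ContinuousLinearMap.id ℝ E := by
    rw [mfd_extChartAt_self, ContinuousLinearMap.inverse_id]
  exact (DFunLike.congr_fun hinverse _).trans (congrFun VectorField.lieBracketWithin_univ _)

end VectorFields

section Reeb

variable {E : Type*} [NormedAddCommGroup E] [NormedSpace ℝ E]
  {M : Type*} [TopologicalSpace M] [ChartedSpace E M] {k : ℕ} {η : DForm E M 1 k}

namespace IsKContactForm

theorem eq_zero (hη : IsKContactForm η) {x : M} {v : E} (hv : formAt η x ![v] = 0)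
    (hdv : ∀ v', formAt (dExt η) x ![v, v'] = 0) : v = 0 := by
  have hmem : v ∈ kerForm η x ⊓ kerForm (dExt η) x :=
    ⟨mem_kerForm_one.2 hv, mem_kerForm_two.2 hdv⟩
  rwa [hη.inf_eq_bot x] at hmem

theorem exists_reeb (hη : IsKContactForm η) (x : M) :
    ∃ r : (Fin k → ℝ) →L[ℝ] E, ∀ w, formAt η x ![r w] = w ∧
      ∀ v, formAt (dExt η) x ![r w, v] = 0 := by
  let S : Submodule ℝ E := kerForm (dExt η) x
  let T : S →ₗ[ℝ] (Fin k → ℝ) := (oneFormCLM (formAt η x)).toLinearMap.domRestrict S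
  have hT : Function.Injective T := (injective_iff_map_eq_zero T).2 fun v hv =>
    Subtype.ext (hη.eq_zero ((oneFormCLM_apply _ _).symm.trans hv) (mem_kerForm_two.1 v.2))
  have hrank : Module.finrank ℝ S = Module.finrank ℝ (Fin k → ℝ) := by
    rw [Module.finrank_fin_fun]
    exact hη.rank_ker_d x
  let e := LinearEquiv.ofInjectiveOfFinrankEq T hT hrank
  refine ⟨LinearMap.toContinuousLinearMap (S.subtype ∘ₗ e.symm.toLinearMap), fun w => ⟨?_, ?_⟩⟩
  · rw [← oneFormCLM_apply]
    exact e.apply_symm_apply w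
  · exact mem_kerForm_two.1 (e.symm w).2

/-- The Reeb vector fields at `x`, combined into the linear map `w ↦ ∑ w_α R_α(x)`. -/
def reeb (hη : IsKContactForm η) (x : M) : (Fin k → ℝ) →L[ℝ] E :=
  (hη.exists_reeb x).choose

variable (hη : IsKContactForm η)
include hη

theorem formAt_reeb (x : M) (w : Fin k → ℝ) : formAt η x ![hη.reeb x w] = w :=
  ((hη.exists_reeb x).choose_spec w).1

theorem formAt_dExt_reeb (x : M) (w : Fin k → ℝ) (v : E) :
    formAt (dExt η) x ![hη.reeb x w, v] = 0 :=
  ((hη.exists_reeb x).choose_spec w).2 v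

theorem eq_reeb {x : M} {v : E} (h : ∀ v', formAt (dExt η) x ![v, v'] = 0) :
    v = hη.reeb x (formAt η x ![v]) := by
  refine sub_eq_zero.1 (hη.eq_zero (x := x) ?_ fun v' => ?_)
  · rw [← oneFormCLM_apply, map_sub, oneFormCLM_apply, oneFormCLM_apply, hη.formAt_reeb, sub_self]
  · rw [← twoFormCLM_apply, map_sub, sub_apply, twoFormCLM_apply, twoFormCLM_apply,
      hη.formAt_dExt_reeb, h, sub_self]

/-- The coordinate expression of the Reeb vector fields, combined into the linear map
`w ↦ ∑ w_α R_α`, in the preferred chart at `x₀`. -/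
def localRepReeb (x₀ : M) (y : E) : (Fin k → ℝ) →L[ℝ] E :=
  (mfd E E (extChartAt 𝓘(ℝ, E) x₀).symm y).inverse.comp
    (hη.reeb ((extChartAt 𝓘(ℝ, E) x₀).symm y))

variable [IsManifold 𝓘(ℝ, E) ∞ M] {x₀ x : M} {y : E}

theorem eq_zero_of_localRep (hy : y ∈ (extChartAt 𝓘(ℝ, E) x₀).target) {v : E}
    (hv : localRep η x₀ y ![v] = 0) (hdv : ∀ v', localRep (dExt η) x₀ y ![v, v'] = 0) : v = 0 := by
  obtain ⟨e, he⟩ := isInvertible_mfd_extChartAt_symm hy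
  have hev : e v = 0 := by
    refine hη.eq_zero (x := (extChartAt 𝓘(ℝ, E) x₀).symm y) ?_ fun v' => ?_
    · rwa [localRep_apply_one, ← he] at hv
    · have h := hdv (e.symm v')
      rwa [localRep_apply_two, ← he, e.coe_coe, e.apply_symm_apply] at h
  exact e.map_eq_zero_iff.1 hev

theorem mfd_extChartAt_symm_localRepReeb (hy : y ∈ (extChartAt 𝓘(ℝ, E) x₀).target)
    (w : Fin k → ℝ) :
    mfd E E (extChartAt 𝓘(ℝ, E) x₀).symm y (hη.localRepReeb x₀ y w) =
      hη.reeb ((extChartAt 𝓘(ℝ, E) x₀).symm y) w :=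
  mfd_extChartAt_symm_localRepVF (fun x => hη.reeb x w) hy

theorem mfd_extChartAt_reeb (hx : x ∈ (extChartAt 𝓘(ℝ, E) x₀).source) (w : Fin k → ℝ) :
    mfd E E (extChartAt 𝓘(ℝ, E) x₀) x (hη.reeb x w) =
      hη.localRepReeb x₀ (extChartAt 𝓘(ℝ, E) x₀ x) w :=
  mfd_extChartAt_apply_eq_localRepVF (fun x => hη.reeb x w) hx

theorem localRep_localRepReeb (hy : y ∈ (extChartAt 𝓘(ℝ, E) x₀).target) (w : Fin k → ℝ) :
    localRep η x₀ y ![hη.localRepReeb x₀ y w] = w := by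
  rw [localRep_apply_one, hη.mfd_extChartAt_symm_localRepReeb hy, hη.formAt_reeb]

theorem localRep_dExt_localRepReeb (hy : y ∈ (extChartAt 𝓘(ℝ, E) x₀).target)
    (w : Fin k → ℝ) (v : E) : localRep (dExt η) x₀ y ![hη.localRepReeb x₀ y w, v] = 0 := by
  rw [localRep_apply_two, hη.mfd_extChartAt_symm_localRepReeb hy, hη.formAt_dExt_reeb]

variable [FiniteDimensional ℝ E]

theorem contDiffAt_localRepReeb (hy : y ∈ (extChartAt 𝓘(ℝ, E) x₀).target) :
    ContDiffAt ℝ ∞ (hη.localRepReeb x₀) y := by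
  have htarget := isOpen_extChartAt_target (I := 𝓘(ℝ, E)) x₀
  suffices h : ContDiffOn ℝ ∞ (hη.localRepReeb x₀) (extChartAt 𝓘(ℝ, E) x₀).target from
    h.contDiffAt (htarget.mem_nhds hy)
  refine contDiffOn_clm_apply.2 fun w y hy => ContDiffAt.contDiffWithinAt ?_
  have hnhds : ∀ᶠ y' in 𝓝 y, y' ∈ (extChartAt 𝓘(ℝ, E) x₀).target := htarget.mem_nhds hy
  exact contDiffAt_of_one_form_two_form_apply_eq (hη.smooth.contDiffAt_localRep hy)
    (hη.smooth.dExt.contDiffAt_localRep hy) (fun v => hη.eq_zero_of_localRep hy)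
    (hnhds.mono fun y' hy' => hη.localRep_localRepReeb hy' w)
    (hnhds.mono fun y' hy' => hη.localRep_dExt_localRepReeb hy' w)

theorem fderiv_localRepReeb_symm (hy : y ∈ (extChartAt 𝓘(ℝ, E) x₀).target)
    (u w : Fin k → ℝ) :
    fderiv ℝ (hη.localRepReeb x₀) y (hη.localRepReeb x₀ y w) u =
      fderiv ℝ (hη.localRepReeb x₀) y (hη.localRepReeb x₀ y u) w := by
  have hnhds : ∀ᶠ y' in 𝓝 y, y' ∈ (extChartAt 𝓘(ℝ, E) x₀).target :=
    (isOpen_extChartAt_target x₀).mem_nhds hy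
  refine fderiv_symm_of_reeb ((hη.smooth.contDiffAt_localRep hy).of_le two_le_infty)
    ((hη.contDiffAt_localRepReeb hy).differentiableAt (by simp))
    (hnhds.mono fun y' hy' => hη.localRep_localRepReeb hy') (hnhds.mono fun y' hy' w v => ?_)
    (fun v hv hdv => hη.eq_zero_of_localRep hy hv fun v' => ?_) u w
  · rw [← hη.smooth.localRep_dExt hy']
    exact hη.localRep_dExt_localRepReeb hy' w v
  · rw [hη.smooth.localRep_dExt hy]
    exact hdv v'

theorem isSmoothVF_reeb {w : M → Fin k → ℝ} (hw : ContMDiff 𝓘(ℝ, E) 𝓘(ℝ, Fin k → ℝ) ∞ w) :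
    IsSmoothVF (fun x => hη.reeb x (w x)) := by
  intro x₀
  refine contMDiffAt_vfield_iff.2 (ContMDiffAt.congr_of_eventuallyEq (ContMDiffAt.clm_apply
    ((hη.contDiffAt_localRepReeb (mem_extChartAt_target x₀)).contMDiffAt.comp x₀
      (contMDiffAt_extChartAt_of_mem_source (mem_extChartAt_source x₀))) (hw x₀)) ?_)
  filter_upwards [extChartAt_source_mem_nhds (I := 𝓘(ℝ, E)) x₀] with x hx
  exact (mfd_extChartAt_apply_eq_localRepVF (fun x => hη.reeb x (w x)) hx).symm.trans
    (hη.mfd_extChartAt_reeb hx (w x))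

theorem isReebFamily : IsReebFamily η fun α x => hη.reeb x (Pi.single α 1) where
  smooth _ := hη.isSmoothVF_reeb contMDiff_const
  apply _ x := hη.formAt_reeb x _
  mem_ker _ x := (mem_kerForm_two (E := E)).2 (hη.formAt_dExt_reeb x _)

end IsKContactForm

end Reeb

section Plaques

variable {E : Type*} [NormedAddCommGroup E] [NormedSpace ℝ E]
  {M : Type*} [TopologicalSpace M] [ChartedSpace E M] {k : ℕ} {η : DForm E M 1 k}

/-- `C^1` curves tangent to the Reeb distribution `ker dη`. -/
structure IsReebCurve (η : DForm E M 1 k) (γ : ℝ → M) : Prop where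
  contMDiff : ContMDiff 𝓘(ℝ, ℝ) 𝓘(ℝ, E) 1 γ
  mem_kerForm : ∀ t : ℝ, mfderiv 𝓘(ℝ, ℝ) 𝓘(ℝ, E) γ t (1 : ℝ) ∈ kerForm (dExt η) (γ t)

theorem IsReebCurve.leafProj_eq {γ : ℝ → M} (hγ : IsReebCurve η γ) :
    leafProj η (γ 0) = leafProj η (γ 1) :=
  Quotient.sound (.rel _ _ ⟨γ, hγ.contMDiff, hγ.mem_kerForm, rfl, rfl⟩)

theorem iff_of_leafProj_eq {p : M → Prop}
    (hp : ∀ γ : ℝ → M, IsReebCurve η γ → (p (γ 0) ↔ p (γ 1))) {x y : M}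
    (h : leafProj η x = leafProj η y) : p x ↔ p y := by
  induction (Quotient.exact h : Relation.EqvGen (TangentlyJoined η) x y) with
  | rel _ _ hxy =>
    obtain ⟨γ, hγ, hker, rfl, rfl⟩ := hxy
    exact hp γ ⟨hγ, hker⟩
  | refl _ => rfl
  | symm _ _ hxy ih => exact (ih (Quotient.sound hxy)).symm
  | trans _ _ _ hxy hyz ih₁ ih₂ => exact (ih₁ (Quotient.sound hxy)).trans (ih₂ (Quotient.sound hyz))

namespace IsKContactForm

variable (hη : IsKContactForm η)

/-- `ψ` is an integral map of the Reeb distribution at `w`: its differential there is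
`u ↦ ∑ u_α R_α`. A plaque is a map with this property on a ball. -/
def IsPlaqueAt (ψ : (Fin k → ℝ) → M) (w : Fin k → ℝ) : Prop :=
  HasMFDerivAt 𝓘(ℝ, Fin k → ℝ) 𝓘(ℝ, E) ψ w (hη.reeb (ψ w))

variable {hη} {ψ ψ₁ ψ₂ : (Fin k → ℝ) → M} {w a : Fin k → ℝ} {r : ℝ} {γ : ℝ → M}

theorem IsPlaqueAt.comp_add_const (h : hη.IsPlaqueAt ψ (w + a)) :
    hη.IsPlaqueAt (fun u => ψ (u + a)) w :=
  HasMFDerivAt.comp (f := fun u : Fin k → ℝ => u + a) (g := ψ) w h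
    ((hasFDerivAt_id w).add_const a).hasMFDerivAt

theorem mfd_eq_reeb (hη : IsKContactForm η) (hγ : IsReebCurve η γ) (t : ℝ) :
    mfd ℝ E γ t 1 = hη.reeb (γ t) (formAt η (γ t) ![mfd ℝ E γ t 1]) :=
  hη.eq_reeb (mem_kerForm_two.1 (hγ.mem_kerForm t))

variable [IsManifold 𝓘(ℝ, E) ∞ M]

theorem IsPlaqueAt.hasFDerivAt (h : hη.IsPlaqueAt ψ w) {x₀ : M}
    (hx : ψ w ∈ (extChartAt 𝓘(ℝ, E) x₀).source) :
    HasFDerivAt (fun u => extChartAt 𝓘(ℝ, E) x₀ (ψ u))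
      (hη.localRepReeb x₀ (extChartAt 𝓘(ℝ, E) x₀ (ψ w))) w := by
  have hchart :=
    ((contMDiffAt_extChartAt_of_mem_source hx).mdifferentiableAt (by simp)).hasMFDerivAt
  refine (hasMFDerivAt_iff_hasFDerivAt.1 (HasMFDerivAt.comp w hchart h)).congr_fderiv ?_
  ext1 u
  exact hη.mfd_extChartAt_reeb hx u

theorem isPlaqueAt_extChartAt_symm_comp {φ : (Fin k → ℝ) → E} {x₀ : M}
    (h : HasFDerivAt φ (hη.localRepReeb x₀ (φ w)) w)
    (hx : φ w ∈ (extChartAt 𝓘(ℝ, E) x₀).target) :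
    hη.IsPlaqueAt (fun u => (extChartAt 𝓘(ℝ, E) x₀).symm (φ u)) w := by
  have hchart := ((contMDiffAt_extChartAt_symm hx).mdifferentiableAt (by simp)).hasMFDerivAt
  have hderiv : (mfd E E (extChartAt 𝓘(ℝ, E) x₀).symm (φ w)).comp (hη.localRepReeb x₀ (φ w)) =
      hη.reeb ((extChartAt 𝓘(ℝ, E) x₀).symm (φ w)) := by
    ext1 u
    exact hη.mfd_extChartAt_symm_localRepReeb hx u
  rw [IsPlaqueAt, ← hderiv]
  exact HasMFDerivAt.comp w hchart h.hasMFDerivAt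

section IsReebCurve

variable (hη)
include hη

theorem hasDerivAt_extChartAt_comp (hγ : IsReebCurve η γ) {x₀ : M} {t : ℝ}
    (hx : γ t ∈ (extChartAt 𝓘(ℝ, E) x₀).source) :
    HasDerivAt (fun s => extChartAt 𝓘(ℝ, E) x₀ (γ s))
      (hη.localRepReeb x₀ (extChartAt 𝓘(ℝ, E) x₀ (γ t)) (formAt η (γ t) ![mfd ℝ E γ t 1])) t := by
  have hchart :=
    ((contMDiffAt_extChartAt_of_mem_source hx).mdifferentiableAt (by simp)).hasMFDerivAt
  have hderiv : HasFDerivAt (fun s => extChartAt 𝓘(ℝ, E) x₀ (γ s))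
      ((mfd E E (extChartAt 𝓘(ℝ, E) x₀) (γ t)).comp (mfd ℝ E γ t)) t :=
    hasMFDerivAt_iff_hasFDerivAt.1 <| HasMFDerivAt.comp t hchart
      ((hγ.contMDiff t).mdifferentiableAt (by simp)).hasMFDerivAt
  refine hderiv.hasDerivAt.congr_deriv ?_
  rw [← hη.mfd_extChartAt_reeb hx, ← hη.mfd_eq_reeb hγ]
  rfl

theorem continuous_formAt_mfd (hγ : IsReebCurve η γ) :
    Continuous fun t => formAt η (γ t) ![mfd ℝ E γ t 1] := by
  refine continuous_iff_continuousAt.2 fun t => ?_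
  set φ := extChartAt 𝓘(ℝ, E) (γ t)
  have hsource : ∀ᶠ s in 𝓝 t, γ s ∈ φ.source :=
    (hγ.contMDiff t).continuousAt (extChartAt_source_mem_nhds (γ t))
  have hφγ : ContDiffAt ℝ 1 (fun s => φ (γ s)) t :=
    (((contMDiffAt_extChartAt_of_mem_source (mem_extChartAt_source (γ t))).of_le
      (by simp)).comp t (hγ.contMDiff t)).contDiffAt
  have hderiv : ContinuousAt (deriv fun s => φ (γ s)) t :=
    (hφγ.fderiv_right (m := 0) (by simp)).continuousAt.clm_apply continuousAt_const
  have hform : ContinuousAt (fun s => localRep η (γ t) (φ (γ s))) t :=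
    ContinuousAt.comp (g := localRep η (γ t))
      (hη.smooth.contDiffAt_localRep (mem_extChartAt_target (γ t))).continuousAt hφγ.continuousAt
  refine ((oneFormCLM.continuous.continuousAt.comp hform).clm_apply hderiv).congr ?_
  filter_upwards [hsource] with s hs
  rw [Function.comp_apply, oneFormCLM_apply, (hη.hasDerivAt_extChartAt_comp hγ hs).deriv,
    hη.localRep_localRepReeb (φ.map_source hs)]

end IsReebCurve

variable [FiniteDimensional ℝ E]

theorem exists_plaque (hη : IsKContactForm η) (x₀ : M) :
    ∃ r > 0, ∃ ψ : (Fin k → ℝ) → M, ψ 0 = x₀ ∧ ∀ w ∈ ball 0 r, hη.IsPlaqueAt ψ w := by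
  have hx := mem_extChartAt_target (I := 𝓘(ℝ, E)) x₀
  have htarget := (isOpen_extChartAt_target (I := 𝓘(ℝ, E)) x₀).mem_nhds hx
  obtain ⟨r, hr, φ, hφ0, hφ⟩ := exists_total_solution
    ((hη.contDiffAt_localRepReeb hx).of_le two_le_infty)
    (mem_of_superset htarget fun y hy => hη.fderiv_localRepReeb_symm hy)
  have hcont : ContinuousAt φ 0 := (hφ 0 (mem_ball_self hr)).continuousAt
  obtain ⟨s, hs, hball⟩ := Metric.mem_nhds_iff.1 (hcont (hφ0.symm ▸ htarget))
  refine ⟨min r s, lt_min hr hs, fun u => (extChartAt 𝓘(ℝ, E) x₀).symm (φ u), ?_, fun w hw => ?_⟩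
  · simp only [hφ0, extChartAt_to_inv]
  · exact isPlaqueAt_extChartAt_symm_comp (hφ w (ball_subset_ball (min_le_left _ _) hw))
      (hball (ball_subset_ball (min_le_right _ _) hw))

theorem eventuallyEq_of_isPlaqueAt (h₁ : ∀ᶠ u in 𝓝 w, hη.IsPlaqueAt ψ₁ u)
    (h₂ : ∀ᶠ u in 𝓝 w, hη.IsPlaqueAt ψ₂ u) (h : ψ₁ w = ψ₂ w) : ψ₁ =ᶠ[𝓝 w] ψ₂ := by
  set φ := extChartAt 𝓘(ℝ, E) (ψ₁ w)
  have hsource := extChartAt_source_mem_nhds (I := 𝓘(ℝ, E)) (ψ₁ w)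
  have hsource₁ : ∀ᶠ u in 𝓝 w, ψ₁ u ∈ φ.source := h₁.self_of_nhds.continuousAt hsource
  have hsource₂ : ∀ᶠ u in 𝓝 w, ψ₂ u ∈ φ.source :=
    h₂.self_of_nhds.continuousAt (by rwa [← h])
  have heq := eventuallyEq_of_total_solution (A := hη.localRepReeb (ψ₁ w))
    (ψ₁ := fun u => φ (ψ₁ u)) (ψ₂ := fun u => φ (ψ₂ u))
    ((hη.contDiffAt_localRepReeb (mem_extChartAt_target (ψ₁ w))).of_le (by simp))
    (by filter_upwards [h₁, hsource₁] with u hu hu' using hu.hasFDerivAt hu')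
    (by filter_upwards [h₂, hsource₂] with u hu hu' using hu.hasFDerivAt hu') (by rw [h])
  filter_upwards [heq, hsource₁, hsource₂] with u hu hu₁ hu₂ using φ.injOn hu₁ hu₂ hu

theorem eqOn_of_isPlaqueAt [T2Space M] {B : Set (Fin k → ℝ)} (hB : IsOpen B)
    (hB' : IsPreconnected B) (h₁ : ∀ w ∈ B, hη.IsPlaqueAt ψ₁ w)
    (h₂ : ∀ w ∈ B, hη.IsPlaqueAt ψ₂ w) (hw : w ∈ B) (h : ψ₁ w = ψ₂ w) : EqOn ψ₁ ψ₂ B := by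
  have hlocal : ∀ u ∈ B, ψ₁ u = ψ₂ u → ψ₁ =ᶠ[𝓝 u] ψ₂ := fun u hu hu' =>
    eventuallyEq_of_isPlaqueAt (mem_of_superset (hB.mem_nhds hu) h₁)
      (mem_of_superset (hB.mem_nhds hu) h₂) hu'
  suffices hsub : B ⊆ {u | ψ₁ =ᶠ[𝓝 u] ψ₂} from fun u hu => (hsub hu).eq_of_nhds
  refine hB'.subset_of_closure_inter_subset isOpen_setOfPred_eventually_nhds
    ⟨w, hw, hlocal w hw h⟩ fun u ⟨hu, huB⟩ => hlocal u huB ?_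
  have : (𝓝[{u | ψ₁ =ᶠ[𝓝 u] ψ₂}] u).NeBot := mem_closure_iff_nhdsWithin_neBot.1 hu
  refine tendsto_nhds_unique (l := 𝓝[{u | ψ₁ =ᶠ[𝓝 u] ψ₂}] u)
    ((h₁ u huB).continuousAt.mono_left nhdsWithin_le_nhds)
    (((h₂ u huB).continuousAt.mono_left nhdsWithin_le_nhds).congr' ?_)
  filter_upwards [self_mem_nhdsWithin] with z hz using (EventuallyEq.eq_of_nhds hz).symm

theorem contMDiffAt_of_isPlaqueAt (h : ∀ᶠ u in 𝓝 w, hη.IsPlaqueAt ψ u) :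
    ContMDiffAt 𝓘(ℝ, Fin k → ℝ) 𝓘(ℝ, E) 1 ψ w := by
  set φ := extChartAt 𝓘(ℝ, E) (ψ w)
  have hsource : ∀ᶠ u in 𝓝 w, ψ u ∈ φ.source :=
    h.self_of_nhds.continuousAt (extChartAt_source_mem_nhds (ψ w))
  have hφψ : ContDiffAt ℝ 1 (fun u => φ (ψ u)) w := by
    refine contDiffAt_one_iff.2 ⟨fun u => hη.localRepReeb (ψ w) (φ (ψ u)), _, h.and hsource,
      fun u ⟨hu, hu'⟩ => ?_, fun u ⟨hu, hu'⟩ => hu.hasFDerivAt hu'⟩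
    exact (ContinuousAt.comp (f := fun u => φ (ψ u)) (g := hη.localRepReeb (ψ w))
      (hη.contDiffAt_localRepReeb (φ.map_source hu')).continuousAt
      (hu.hasFDerivAt hu').continuousAt).continuousWithinAt
  refine (ContMDiffAt.comp (g := φ.symm) w ((contMDiffAt_extChartAt_symm
    (mem_extChartAt_target (ψ w))).of_le (by simp)) hφψ.contMDiffAt).congr_of_eventuallyEq ?_
  filter_upwards [hsource] with u hu using (φ.left_inv hu).symm

theorem exists_eventuallyEq_plaque_comp {t₀ : ℝ} (hγ : IsReebCurve η γ)
    (hψ : ∀ᶠ u in 𝓝 w, hη.IsPlaqueAt ψ u) (h : γ t₀ = ψ w) :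
    ∃ q : ℝ → Fin k → ℝ, Tendsto q (𝓝 t₀) (𝓝 w) ∧ γ =ᶠ[𝓝 t₀] ψ ∘ q := by
  let c : ℝ → Fin k → ℝ := fun t => formAt η (γ t) ![mfd ℝ E γ t 1]
  have hc : Continuous c := hη.continuous_formAt_mfd hγ
  let q : ℝ → Fin k → ℝ := fun t => w + ∫ s in t₀..t, c s
  have hq : ∀ t, HasDerivAt q (c t) t := fun t =>
    (hc.integral_hasStrictDerivAt t₀ t).hasDerivAt.const_add w
  have hq₀ : q t₀ = w := by simp [q]
  refine ⟨q, hq₀ ▸ (hq t₀).continuousAt, ?_⟩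
  set φ := extChartAt 𝓘(ℝ, E) (γ t₀)
  have hsource := extChartAt_source_mem_nhds (I := 𝓘(ℝ, E)) (γ t₀)
  have hsourceγ : ∀ᶠ t in 𝓝 t₀, γ t ∈ φ.source := (hγ.contMDiff t₀).continuousAt hsource
  have hsourceψ : ∀ᶠ u in 𝓝 (q t₀), ψ u ∈ φ.source :=
    hq₀ ▸ hψ.self_of_nhds.continuousAt (by rwa [← h])
  have heq := eventuallyEq_total_solution_comp (A := hη.localRepReeb (γ t₀))
    (ψ := fun u => φ (ψ u)) (y := fun t => φ (γ t)) (q := q) (c := c)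
    ((hη.contDiffAt_localRepReeb (mem_extChartAt_target (γ t₀))).of_le (by simp))
    (hsourceγ.mono fun t => hη.hasDerivAt_extChartAt_comp hγ) (Eventually.of_forall hq)
    hc.continuousAt
    (by filter_upwards [hq₀ ▸ hψ, hsourceψ] with u hu hu' using hu.hasFDerivAt hu')
    (by rw [hq₀, h])
  filter_upwards [heq, hsourceγ, (hq t₀).continuousAt.eventually hsourceψ] with t ht h₁ h₂
    using φ.injOn h₁ h₂ ht

/-- The segment from `0` to `w` is reparametrised by a sine, which extends it to a curve defined on
all of `ℝ` that does not leave the ball. -/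
theorem leafProj_eq_of_isPlaqueAt (hψ : ∀ w ∈ ball 0 r, hη.IsPlaqueAt ψ w) (hw : w ∈ ball 0 r) :
    leafProj η (ψ 0) = leafProj η (ψ w) := by
  let f : ℝ → Fin k → ℝ := fun t => Real.sin (Real.pi / 2 * t) • w
  have hf : ContDiff ℝ 1 f := by fun_prop
  have hfball : ∀ t, f t ∈ ball (0 : Fin k → ℝ) r := fun t => by
    rw [mem_ball_zero_iff] at hw ⊢
    refine lt_of_le_of_lt ?_ hw
    rw [norm_smul]
    exact mul_le_of_le_one_left (norm_nonneg _) (Real.abs_sin_le_one _)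
  have hderiv : ∀ t, mfd ℝ E (fun t => ψ (f t)) t 1 = hη.reeb (ψ (f t)) (fderiv ℝ f t 1) :=
    fun t => DFunLike.congr_fun (HasMFDerivAt.comp t (hψ _ (hfball t))
      (hf.differentiable (by simp) t).hasFDerivAt.hasMFDerivAt).mfderiv 1
  have hcurve : IsReebCurve η fun t => ψ (f t) :=
    { contMDiff := fun t => (contMDiffAt_of_isPlaqueAt (mem_of_superset
        (isOpen_ball.mem_nhds (hfball t)) hψ)).comp t hf.contDiffAt.contMDiffAt
      mem_kerForm := fun t => (mem_kerForm_two (E := E)).2 fun v =>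
        (congrArg (fun u => formAt (dExt η) (ψ (f t)) ![u, v]) (hderiv t)).trans
          (hη.formAt_dExt_reeb _ _ v) }
  simpa [f] using hcurve.leafProj_eq

end IsKContactForm

end Plaques

section LeafCover

variable {E : Type*} [NormedAddCommGroup E] [NormedSpace ℝ E]
  {M : Type*} [TopologicalSpace M] [ChartedSpace E M] {k : ℕ} {η : DForm E M 1 k}

namespace IsKContactForm

variable (hη : IsKContactForm η)

/-- There is a plaque centred at `c`, defined on the ball of radius `1 / (n + 1)`. -/
def HasPlaque (c : M) (n : ℕ) : Prop :=
  ∃ ψ : (Fin k → ℝ) → M, ψ 0 = c ∧ ∀ w ∈ ball 0 (1 / ((n : ℝ) + 1)), hη.IsPlaqueAt ψ w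

open Classical in
/-- A plaque centred at `c`, defined on the ball of radius `1 / (n + 1)` if there is one, and the
constant map otherwise. -/
def plaque (c : M) (n : ℕ) : (Fin k → ℝ) → M :=
  if h : hη.HasPlaque c n then h.choose else fun _ => c

/-- The point reached from `x₀` by moving successively along the given rational vectors, each time
inside a plaque whose size is prescribed by the accompanying natural number. -/
def follow (x₀ : M) (l : List (ℕ × (Fin k → ℚ))) : M :=
  l.foldl (fun c a => hη.plaque c a.1 fun i => (a.2 i : ℝ)) x₀

/-- The union of the plaques centred at the points reached from `x₀` by rational moves. -/
def plaqueUnion (x₀ : M) : Set M :=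
  {y | ∃ l n, hη.HasPlaque (hη.follow x₀ l) n ∧
    ∃ w ∈ ball (0 : Fin k → ℝ) (1 / ((n : ℝ) + 1)), y = hη.plaque (hη.follow x₀ l) n w}

variable {hη}

theorem HasPlaque.plaque_zero {c : M} {n : ℕ} (h : hη.HasPlaque c n) : hη.plaque c n 0 = c := by
  rw [plaque, dif_pos h]
  exact h.choose_spec.1

theorem HasPlaque.isPlaqueAt {c : M} {n : ℕ} (h : hη.HasPlaque c n) {w : Fin k → ℝ}
    (hw : w ∈ ball 0 (1 / ((n : ℝ) + 1))) : hη.IsPlaqueAt (hη.plaque c n) w := by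
  rw [plaque, dif_pos h]
  exact h.choose_spec.2 w hw

theorem HasPlaque.eventually_isPlaqueAt {c : M} {n : ℕ} (h : hη.HasPlaque c n) {w : Fin k → ℝ}
    (hw : w ∈ ball 0 (1 / ((n : ℝ) + 1))) : ∀ᶠ u in 𝓝 w, hη.IsPlaqueAt (hη.plaque c n) u :=
  mem_of_superset (isOpen_ball.mem_nhds hw) fun _ => h.isPlaqueAt

variable [IsManifold 𝓘(ℝ, E) ∞ M] [FiniteDimensional ℝ E] {x₀ : M} {γ : ℝ → M} {t₀ : ℝ}
  {ψ : (Fin k → ℝ) → M} {q : Fin k → ℝ}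

theorem mem_plaqueUnion_self (hη : IsKContactForm η) (x₀ : M) : x₀ ∈ hη.plaqueUnion x₀ := by
  obtain ⟨r, hr, ψ, hψ0, hψ⟩ := hη.exists_plaque x₀
  obtain ⟨n, hn⟩ := exists_nat_one_div_lt hr
  have h : hη.HasPlaque (hη.follow x₀ []) n :=
    ⟨ψ, hψ0, fun w hw => hψ w (ball_subset_ball hn.le hw)⟩
  exact ⟨[], n, h, 0, mem_ball_self (by positivity), h.plaque_zero.symm⟩

theorem eventually_mem_plaqueUnion (hγ : IsReebCurve η γ) (h : γ t₀ ∈ hη.plaqueUnion x₀) :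
    ∀ᶠ t in 𝓝 t₀, γ t ∈ hη.plaqueUnion x₀ := by
  obtain ⟨l, n, hc, w, hw, hγw⟩ := h
  obtain ⟨q, hq, hγq⟩ := exists_eventuallyEq_plaque_comp hγ (hc.eventually_isPlaqueAt hw) hγw
  filter_upwards [hq (isOpen_ball.mem_nhds hw), hγq] with t hqt hγt
  exact ⟨l, n, hc, q t, hqt, hγt⟩

theorem exists_follow_eq_of_mem_plaqueUnion (hψ : ∀ᶠ u in 𝓝 q, hη.IsPlaqueAt ψ u)
    (h : ψ q ∈ hη.plaqueUnion x₀) {S : Set (Fin k → ℝ)} (hS : S ∈ 𝓝 q) :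
    ∃ l, ∃ a ∈ S, hη.follow x₀ l = ψ a := by
  obtain ⟨l, m, hc, w, hw, hψw⟩ := h
  have htranslate : Tendsto (fun u => u + (q - w)) (𝓝 w) (𝓝 q) := by
    simpa using (continuous_add_const (q - w)).tendsto w
  have heq : hη.plaque (hη.follow x₀ l) m =ᶠ[𝓝 w] fun u => ψ (u + (q - w)) :=
    eventuallyEq_of_isPlaqueAt (hc.eventually_isPlaqueAt hw)
      ((htranslate.eventually hψ).mono fun u hu => hu.comp_add_const)
      (by rw [← hψw, add_sub_cancel])
  have hdense : DenseRange (fun (u : Fin k → ℚ) (i : Fin k) => (u i : ℝ)) :=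
    DenseRange.piMap fun _ => Rat.denseRange_cast
  obtain ⟨_, ⟨hu, huS⟩, u, rfl⟩ :=
    mem_closure_iff_nhds.1 (hdense w) _ (inter_mem heq (htranslate hS))
  exact ⟨l ++ [(m, u)], _, huS, (List.foldl_append ..).trans hu⟩

theorem mem_plaqueUnion_of_follow_eq [T2Space M] {r : ℝ} (hψ : ∀ w ∈ ball 0 r, hη.IsPlaqueAt ψ w)
    {n : ℕ} (hn : 1 / ((n : ℝ) + 1) < r / 2) {l : List (ℕ × (Fin k → ℚ))} {a : Fin k → ℝ}
    (ha : a ∈ ball 0 (1 / ((n : ℝ) + 1))) (hl : hη.follow x₀ l = ψ a) :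
    ψ 0 ∈ hη.plaqueUnion x₀ := by
  rw [mem_ball_zero_iff] at ha
  have htranslate : ∀ z ∈ ball (0 : Fin k → ℝ) (1 / ((n : ℝ) + 1)),
      hη.IsPlaqueAt (fun z => ψ (z + a)) z := fun z hz => by
    rw [mem_ball_zero_iff] at hz
    refine (hψ _ (mem_ball_zero_iff.2 ?_)).comp_add_const
    linarith [norm_add_le z a]
  have hc : hη.HasPlaque (hη.follow x₀ l) n :=
    ⟨fun z => ψ (z + a), by simp only [hl, zero_add], htranslate⟩
  have hneg : -a ∈ ball (0 : Fin k → ℝ) (1 / ((n : ℝ) + 1)) := by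
    rwa [mem_ball_zero_iff, norm_neg]
  refine ⟨l, n, hc, -a, hneg, ?_⟩
  have heq := eqOn_of_isPlaqueAt isOpen_ball (convex_ball _ _).isPreconnected
    (fun z => hc.isPlaqueAt) htranslate (mem_ball_self (by positivity))
    (by rw [hc.plaque_zero, hl, zero_add]) hneg
  rw [heq]
  simp only [neg_add_cancel]

theorem mem_plaqueUnion_of_frequently [T2Space M] (hγ : IsReebCurve η γ)
    (h : ∃ᶠ t in 𝓝 t₀, γ t ∈ hη.plaqueUnion x₀) : γ t₀ ∈ hη.plaqueUnion x₀ := by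
  obtain ⟨r, hr, ψ, hψ0, hψ⟩ := hη.exists_plaque (γ t₀)
  obtain ⟨n, hn⟩ := exists_nat_one_div_lt (half_pos hr)
  obtain ⟨q, hq, hγq⟩ := exists_eventuallyEq_plaque_comp hγ
    (mem_of_superset (ball_mem_nhds 0 hr) hψ) hψ0.symm
  obtain ⟨t, ht, hqt, hγt⟩ := (h.and_eventually
    ((hq.eventually_mem (ball_mem_nhds 0 (Nat.one_div_pos_of_nat (n := n)))).and hγq)).exists
  have hqt' : q t ∈ ball 0 r := ball_subset_ball (by linarith) hqt
  rw [hγt] at ht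
  obtain ⟨l, a, ha, hl⟩ := exists_follow_eq_of_mem_plaqueUnion
    (mem_of_superset (isOpen_ball.mem_nhds hqt') hψ) ht (isOpen_ball.mem_nhds hqt)
  exact hψ0 ▸ mem_plaqueUnion_of_follow_eq hψ hn ha hl

/-- A leaf need not be second countable a priori: it is covered by the countable family of plaques
of `plaqueUnion`, because along a curve tangent to `ker dη` their union is open and closed. -/
theorem mem_plaqueUnion_of_leafProj_eq [T2Space M] {x : M} (h : leafProj η x = leafProj η x₀) :
    x ∈ hη.plaqueUnion x₀ := by
  refine (iff_of_leafProj_eq (p := (· ∈ hη.plaqueUnion x₀)) (fun γ hγ => ?_) h).2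
    (hη.mem_plaqueUnion_self x₀)
  have hclopen : IsClopen {t | γ t ∈ hη.plaqueUnion x₀} :=
    ⟨isClosed_iff_frequently.2 fun t => mem_plaqueUnion_of_frequently hγ,
      isOpen_iff_eventually.2 fun t => eventually_mem_plaqueUnion hγ⟩
  rcases isClopen_iff.1 hclopen with hempty | huniv
  · have hnot := eq_empty_iff_forall_notMem.1 hempty
    exact iff_of_false (hnot 0) (hnot 1)
  · have hmem := eq_univ_iff_forall.1 huniv
    exact iff_of_true (hmem 0) (hmem 1)

end IsKContactForm

end LeafCover

section Submersions

variable {E : Type*} [NormedAddCommGroup E] [NormedSpace ℝ E]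
  {M : Type*} [TopologicalSpace M] [ChartedSpace E M]
  {F : Type*} [NormedAddCommGroup F] [NormedSpace ℝ F]
  {N : Type*} [TopologicalSpace N] [ChartedSpace F N]
  {K : Type*} [NormedAddCommGroup K] [NormedSpace ℝ K] {p : M → N}

theorem mfd_symm_mfd {e : OpenPartialHomeomorph M N} (he : e.MDifferentiable 𝓘(ℝ, E) 𝓘(ℝ, F))
    {x : M} (hx : x ∈ e.source) (v : E) : mfd F E e.symm (e x) (mfd E F e x v) = v :=
  DFunLike.congr_fun (he.symm_comp_deriv hx) v

theorem mfd_mfd_symm {e : OpenPartialHomeomorph M N} (he : e.MDifferentiable 𝓘(ℝ, E) 𝓘(ℝ, F))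
    {y : N} (hy : y ∈ e.target) (u : F) : mfd E F e (e.symm y) (mfd F E e.symm y u) = u :=
  DFunLike.congr_fun (he.comp_symm_deriv hy) u

/-- A pair of charts, `upper` on an open subset of `M` and `lower` on an open subset of `N`, in
which `p : M → N` becomes the first projection `F × K → F`. -/
structure SubmersionChart (E F K : Type*) [NormedAddCommGroup E] [NormedSpace ℝ E]
    [NormedAddCommGroup F] [NormedSpace ℝ F] [NormedAddCommGroup K] [NormedSpace ℝ K]
    {M N : Type*} [TopologicalSpace M] [ChartedSpace E M] [TopologicalSpace N] [ChartedSpace F N]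
    (p : M → N) where
  upper : OpenPartialHomeomorph M (F × K)
  lower : OpenPartialHomeomorph N F
  mapsTo : MapsTo p upper.source lower.source
  lower_apply {x} : x ∈ upper.source → lower (p x) = (upper x).1
  contMDiffAt_upper {x} : x ∈ upper.source → ContMDiffAt 𝓘(ℝ, E) 𝓘(ℝ, F × K) ∞ upper x
  contMDiffAt_upper_symm {z} : z ∈ upper.target → ContMDiffAt 𝓘(ℝ, F × K) 𝓘(ℝ, E) ∞ upper.symm z
  contMDiffAt_lower {y} : y ∈ lower.source → ContMDiffAt 𝓘(ℝ, F) 𝓘(ℝ, F) ∞ lower y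
  contMDiffAt_lower_symm {a} : a ∈ lower.target → ContMDiffAt 𝓘(ℝ, F) 𝓘(ℝ, F) ∞ lower.symm a

theorem exists_submersionChart {x₀ : M}
    (h : Manifold.IsSubmersionAtOfComplement K 𝓘(ℝ, E) 𝓘(ℝ, F) ∞ p x₀) :
    ∃ c : SubmersionChart E F K p, x₀ ∈ c.upper.source := by
  have hwritten : ∀ {x}, x ∈ h.domChart.source →
      h.codChart (p x) = (h.equiv (h.domChart x)).1 := fun {x} hx => by
    have hx' : h.domChart x ∈ (h.domChart.extend 𝓘(ℝ, E)).target := by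
      simpa using h.domChart.map_source hx
    simpa [h.domChart.left_inv hx] using h.writtenInCharts hx'
  exact ⟨{
    upper := h.domChart.transHomeomorph h.equiv.toHomeomorph
    lower := h.codChart
    mapsTo := h.source_subset_preimage_source
    lower_apply := hwritten
    contMDiffAt_upper := fun hx => h.equiv.contDiff.contMDiff.contMDiffAt.comp _
      (contMDiffAt_of_mem_maximalAtlas h.domChart_mem_maximalAtlas hx)
    contMDiffAt_upper_symm := fun {z} hz => ContMDiffAt.comp (g := h.domChart.symm) z
      (contMDiffAt_symm_of_mem_maximalAtlas h.domChart_mem_maximalAtlas hz)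
      h.equiv.symm.contDiff.contMDiff.contMDiffAt
    contMDiffAt_lower := contMDiffAt_of_mem_maximalAtlas h.codChart_mem_maximalAtlas
    contMDiffAt_lower_symm :=
      contMDiffAt_symm_of_mem_maximalAtlas h.codChart_mem_maximalAtlas }, h.mem_domChart_source⟩

namespace SubmersionChart

variable (c : SubmersionChart E F K p) {x : M}

theorem mdifferentiable_upper : c.upper.MDifferentiable 𝓘(ℝ, E) 𝓘(ℝ, F × K) :=
  ⟨fun _ hx => ((c.contMDiffAt_upper hx).mdifferentiableAt (by simp)).mdifferentiableWithinAt,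
    fun _ hz => ((c.contMDiffAt_upper_symm hz).mdifferentiableAt
      (by simp)).mdifferentiableWithinAt⟩

theorem mdifferentiable_lower : c.lower.MDifferentiable 𝓘(ℝ, F) 𝓘(ℝ, F) :=
  ⟨fun _ hy => ((c.contMDiffAt_lower hy).mdifferentiableAt (by simp)).mdifferentiableWithinAt,
    fun _ ha => ((c.contMDiffAt_lower_symm ha).mdifferentiableAt
      (by simp)).mdifferentiableWithinAt⟩

theorem map_upper_symm {z : F × K} (hz : z ∈ c.upper.target) :
    p (c.upper.symm z) = c.lower.symm z.1 := by
  have hx := c.upper.map_target hz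
  rw [← c.lower.left_inv (c.mapsTo hx), c.lower_apply hx, c.upper.right_inv hz]

theorem mfd_lower_mfd (hp : MDifferentiableAt 𝓘(ℝ, E) 𝓘(ℝ, F) p x) (hx : x ∈ c.upper.source)
    (v : E) : mfd F F c.lower (p x) (mfd E F p x v) = (mfd E (F × K) c.upper x v).1 := by
  have hcharts : (fun y => c.lower (p y)) =ᶠ[𝓝 x] fun y => (c.upper y).1 :=
    mem_of_superset (c.upper.open_source.mem_nhds hx) fun _ => c.lower_apply
  rw [← mfd_comp_apply (c.mdifferentiable_lower.mdifferentiableAt (c.mapsTo hx)) hp,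
    mfd_congr hcharts, mfd_comp_apply (g := Prod.fst) (f := c.upper) (E' := F × K)
      differentiableAt_fst.mdifferentiableAt (c.mdifferentiable_upper.mdifferentiableAt hx),
    mfd_eq_fderiv, fderiv_fst]
  rfl

theorem mfd_eq_zero_of_fst_eq_zero (hp : MDifferentiableAt 𝓘(ℝ, E) 𝓘(ℝ, F) p x)
    (hx : x ∈ c.upper.source) {v : E} (hv : (mfd E (F × K) c.upper x v).1 = 0) :
    mfd E F p x v = 0 := by
  rw [← mfd_symm_mfd c.mdifferentiable_lower (c.mapsTo hx) (mfd E F p x v),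
    c.mfd_lower_mfd hp hx, hv, map_zero]

end SubmersionChart

theorem exists_local_section (hp : Manifold.IsSubmersion 𝓘(ℝ, E) 𝓘(ℝ, F) ∞ p) (x₀ : M) :
    ∃ s : N → M, s (p x₀) = x₀ ∧ ∀ᶠ y in 𝓝 (p x₀), p (s y) = y ∧
      ContMDiffAt 𝓘(ℝ, F) 𝓘(ℝ, E) ∞ s y := by
  obtain ⟨c, hx₀⟩ := exists_submersionChart (hp.isSubmersionOfComplement_complement x₀)
  have hpx₀ := c.mapsTo hx₀
  have hcoord : (c.lower (p x₀), (c.upper x₀).2) = c.upper x₀ := by rw [c.lower_apply hx₀]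
  have htarget : ∀ᶠ y in 𝓝 (p x₀), (c.lower y, (c.upper x₀).2) ∈ c.upper.target := by
    refine ContinuousAt.eventually_mem (f := fun y => (c.lower y, (c.upper x₀).2))
      ((c.lower.continuousAt hpx₀).prodMk continuousAt_const)
      (c.upper.open_target.mem_nhds ?_)
    exact hcoord ▸ c.upper.map_source hx₀
  refine ⟨fun y => c.upper.symm (c.lower y, (c.upper x₀).2), ?_, ?_⟩
  · beta_reduce
    rw [hcoord, c.upper.left_inv hx₀]
  · filter_upwards [c.lower.open_source.mem_nhds hpx₀, htarget] with y hy hyt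
    refine ⟨by rw [c.map_upper_symm hyt, c.lower.left_inv hy], ?_⟩
    exact ContMDiffAt.comp (g := c.upper.symm) (f := fun y => (c.lower y, (c.upper x₀).2)) y
      (c.contMDiffAt_upper_symm hyt) ((c.contMDiffAt_lower hy).prodMk_space contMDiffAt_const)

theorem surjective_mfd_of_isSubmersion (hp : Manifold.IsSubmersion 𝓘(ℝ, E) 𝓘(ℝ, F) ∞ p) (x : M) :
    Function.Surjective (mfd E F p x) := fun u => by
  obtain ⟨s, hs, hsection⟩ := exists_local_section hp x
  refine ⟨mfd F E s (p x) u, ?_⟩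
  have hcomp := mfd_comp_apply (g := p) (f := s) (x := p x)
    (hp.contMDiff.mdifferentiableAt (by simp))
    (hsection.self_of_nhds.2.mdifferentiableAt (by simp)) u
  rw [mfd_congr (hsection.mono fun _ hy => hy.1), mfd_id, hs] at hcomp
  exact hcomp.symm

end Submersions

section LeafKernel

theorem dimH_image_le_finrank_of_contDiffAt {V W : Type*} [NormedAddCommGroup V]
    [NormedSpace ℝ V] [FiniteDimensional ℝ V] [NormedAddCommGroup W] [NormedSpace ℝ W]
    {f : V → W} {s : Set V} (hf : ∀ x ∈ s, ContDiffAt ℝ 1 f x) :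
    dimH (f '' s) ≤ Module.finrank ℝ V := by
  have hlip : ∀ x ∈ s, ∃ C : ℝ≥0, ∃ t ∈ 𝓝[s] x, LipschitzOnWith C f t := fun x hx => by
    obtain ⟨C, t, ht, hC⟩ := (hf x hx).exists_lipschitzOnWith
    exact ⟨C, t, mem_nhdsWithin_of_mem_nhds ht, hC⟩
  calc dimH (f '' s) ≤ dimH s := dimH_image_le_of_locally_lipschitzOn hlip
    _ ≤ dimH (univ : Set V) := dimH_mono (subset_univ _)
    _ = Module.finrank ℝ V := Real.dimH_univ_eq_finrank V

namespace IsKContactForm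

variable {E : Type*} [NormedAddCommGroup E] [NormedSpace ℝ E] [FiniteDimensional ℝ E]
  {M : Type*} [TopologicalSpace M] [ChartedSpace E M] [IsManifold 𝓘(ℝ, E) ∞ M] {k : ℕ}
  {η : DForm E M 1 k} (hη : IsKContactForm η)
  {F : Type*} [NormedAddCommGroup F] [NormedSpace ℝ F] [ChartedSpace F (LeafSpace η)]
  {K : Type*} [NormedAddCommGroup K] [NormedSpace ℝ K]
include hη

theorem mfd_leafProj_reeb {x : M} (hp : MDifferentiableAt 𝓘(ℝ, E) 𝓘(ℝ, F) (leafProj η) x)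
    (w : Fin k → ℝ) : mfd E F (leafProj η) x (hη.reeb x w) = 0 := by
  obtain ⟨r, hr, ψ, rfl, hψ⟩ := hη.exists_plaque x
  have hψ' : HasMFDerivAt 𝓘(ℝ, Fin k → ℝ) 𝓘(ℝ, E) ψ 0 (hη.reeb (ψ 0)) := hψ 0 (mem_ball_self hr)
  have hcomp := (HasMFDerivAt.comp 0 hp.hasMFDerivAt hψ').mfderiv
  have hconst : (leafProj η ∘ ψ) =ᶠ[𝓝 0] fun _ => leafProj η (ψ 0) := by
    filter_upwards [ball_mem_nhds 0 hr] with w hw using (leafProj_eq_of_isPlaqueAt hψ hw).symm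
  rw [hconst.mfderiv_eq, mfderiv_const] at hcomp
  exact (DFunLike.congr_fun hcomp w).symm

theorem dimH_image_plaque_le (c : SubmersionChart E F K (leafProj η)) (x : M) (n : ℕ) :
    dimH ((fun w => (c.upper (hη.plaque x n w)).2) ''
      {w | hη.HasPlaque x n ∧ w ∈ ball 0 (1 / ((n : ℝ) + 1)) ∧
        hη.plaque x n w ∈ c.upper.source}) ≤ k := by
  refine (dimH_image_le_finrank_of_contDiffAt ?_).trans (by simp)
  rintro w ⟨hn, hw, hsource⟩
  have hplaque : ContMDiffAt 𝓘(ℝ, Fin k → ℝ) 𝓘(ℝ, E) 1 (hη.plaque x n) w :=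
    contMDiffAt_of_isPlaqueAt (hn.eventually_isPlaqueAt hw)
  exact (((c.contMDiffAt_upper hsource).of_le (by simp)).comp w hplaque).contDiffAt.snd

/-- A leaf is covered by countably many plaques, hence so is a fibre of the projection. -/
theorem finrank_complement_le [T2Space M] [FiniteDimensional ℝ K]
    (c : SubmersionChart E F K (leafProj η)) {x₀ : M} (hx₀ : x₀ ∈ c.upper.source) :
    Module.finrank ℝ K ≤ k := by
  let Z : Set K := {z | ((c.upper x₀).1, z) ∈ c.upper.target}
  have hZ : Z ∈ 𝓝 (c.upper x₀).2 :=
    (c.upper.open_target.preimage (by fun_prop)).mem_nhds (c.upper.map_source hx₀)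
  have hleaf : ∀ z ∈ Z, leafProj η (c.upper.symm ((c.upper x₀).1, z)) = leafProj η x₀ :=
    fun z hz => by
      rw [c.map_upper_symm hz, ← c.map_upper_symm (c.upper.map_source hx₀), c.upper.left_inv hx₀]
  have hcover : Z ⊆ ⋃ i : List (ℕ × (Fin k → ℚ)) × ℕ,
      (fun w => (c.upper (hη.plaque (hη.follow x₀ i.1) i.2 w)).2) ''
        {w | hη.HasPlaque (hη.follow x₀ i.1) i.2 ∧ w ∈ ball 0 (1 / ((i.2 : ℝ) + 1)) ∧
          hη.plaque (hη.follow x₀ i.1) i.2 w ∈ c.upper.source} := fun z hz => by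
    obtain ⟨l, n, hn, w, hw, hplaque⟩ := mem_plaqueUnion_of_leafProj_eq (hη := hη) (hleaf z hz)
    refine mem_iUnion.2 ⟨(l, n), w, ⟨hn, hw, hplaque ▸ c.upper.map_target hz⟩, ?_⟩
    beta_reduce
    rw [← hplaque, c.upper.right_inv hz]
  have hdim : dimH Z ≤ k := by
    refine (dimH_mono hcover).trans ?_
    rw [dimH_iUnion]
    exact iSup_le fun i => hη.dimH_image_plaque_le c _ _
  rw [Real.dimH_of_mem_nhds hZ] at hdim
  exact_mod_cast hdim

theorem mfd_leafProj_eq_zero_iff [T2Space M]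
    (hp : Manifold.IsSubmersion 𝓘(ℝ, E) 𝓘(ℝ, F) ∞ (leafProj η)) {x : M} {v : E} :
    mfd E F (leafProj η) x v = 0 ↔ ∀ v', formAt (dExt η) x ![v, v'] = 0 := by
  have h := hp.isSubmersionOfComplement_complement x
  obtain ⟨c, hx⟩ := exists_submersionChart h
  have : FiniteDimensional ℝ (F × hp.complement) := h.equiv.toLinearEquiv.finiteDimensional
  have : FiniteDimensional ℝ F :=
    FiniteDimensional.of_surjective (LinearMap.fst ℝ F hp.complement) LinearMap.fst_surjective
  have : FiniteDimensional ℝ hp.complement :=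
    FiniteDimensional.of_surjective (LinearMap.snd ℝ F hp.complement) LinearMap.snd_surjective
  let P : E →ₗ[ℝ] F := mfd E F (leafProj η) x
  let S : Submodule ℝ E := kerForm (dExt η) x
  have hle : S ≤ LinearMap.ker P := fun v hv => by
    have hreeb := hη.mfd_leafProj_reeb (hp.contMDiff.mdifferentiableAt (x := x) (by simp))
      (formAt η x ![v])
    rwa [← hη.eq_reeb (mem_kerForm_two.1 hv)] at hreeb
  have hrank : Module.finrank ℝ (LinearMap.ker P) ≤ k := by
    have hsum := LinearMap.finrank_range_add_finrank_ker P
    rw [LinearMap.range_eq_top.2 (surjective_mfd_of_isSubmersion hp x), finrank_top,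
      h.equiv.toLinearEquiv.finrank_eq, Module.finrank_prod] at hsum
    have hcomplement := hη.finrank_complement_le c hx
    lia
  have heq : S = LinearMap.ker P :=
    Submodule.eq_of_le_of_finrank_le hle (hrank.trans (hη.rank_ker_d x).ge)
  rw [← mem_kerForm_two (E := E)]
  exact (SetLike.ext_iff.1 heq v).symm

end IsKContactForm

end LeafKernel

section ClosedForms

variable {E : Type*} [NormedAddCommGroup E] [NormedSpace ℝ E]
  {W : Type*} [NormedAddCommGroup W] [NormedSpace ℝ W] {n : ℕ}

theorem map_eq_zero_of_curryLeft_eq_zero {f : E [⋀^Fin (n + 1)]→L[ℝ] W} {v : Fin (n + 1) → E}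
    {i : Fin (n + 1)} (h : f.curryLeft (v i) = 0) : f v = 0 := by
  have hswap : f (v ∘ Equiv.swap 0 i) = 0 := by
    have := DFunLike.congr_fun h (Fin.tail (v ∘ Equiv.swap 0 i))
    rwa [ContinuousAlternatingMap.curryLeft_apply_apply, Matrix.vecCons,
      show v i = (v ∘ Equiv.swap 0 i) 0 by simp, Fin.cons_self_tail] at this
  have hperm := f.toAlternatingMap.map_perm v (Equiv.swap 0 i)
  exact (smul_eq_zero_iff_eq _).1 (hperm.symm.trans hswap)

theorem map_eq_map_of_curryLeft_sub_eq_zero {f : E [⋀^Fin (n + 1)]→L[ℝ] W}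
    {v w : Fin (n + 1) → E} (h : ∀ i, f.curryLeft (v i - w i) = 0) : f v = f w := by
  have hsub := f.toMultilinearMap.map_sub_map_piecewise v w Finset.univ
  rw [Finset.piecewise_univ, Finset.sum_eq_zero] at hsub
  · exact sub_eq_zero.1 hsub
  · exact fun i _ => map_eq_zero_of_curryLeft_eq_zero (f := f) (i := i) (by simpa using h i)

theorem fderiv_apply_eq_zero_of_extDeriv_eq_zero {Ω : E → E [⋀^Fin (n + 1)]→L[ℝ] W} {x u : E}
    (hΩ : DifferentiableAt ℝ Ω x) (hclosed : extDeriv Ω x = 0)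
    (hu : ∀ᶠ y in 𝓝 x, (Ω y).curryLeft u = 0) : fderiv ℝ Ω x u = 0 := by
  ext1 v
  have hterm : ∀ i : Fin (n + 1),
      fderiv ℝ (fun y => Ω y (i.succ.removeNth (Fin.cons u v : Fin (n + 2) → E))) x = 0 := by
    intro i
    have hzero : (fun y => Ω y (i.succ.removeNth (Fin.cons u v : Fin (n + 2) → E)))
        =ᶠ[𝓝 x] fun _ => 0 :=
      hu.mono fun y hy => map_eq_zero_of_curryLeft_eq_zero (i := 0) hy
    rw [hzero.fderiv_eq, fderiv_fun_const, Pi.zero_apply]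
  have h := extDeriv_apply hΩ (Fin.cons u v : Fin (n + 2) → E)
  rw [Fin.sum_univ_succ, Finset.sum_eq_zero fun i _ => by rw [hterm]; simp] at h
  simpa [hclosed, fderiv_continuousAlternatingMap_apply_const_apply hΩ] using h.symm

theorem eq_of_extDeriv_eq_zero {Ω : E → E [⋀^Fin (n + 1)]→L[ℝ] W} {U : Set E} (hU : IsOpen U)
    (hΩ : ∀ z ∈ U, DifferentiableAt ℝ Ω z) (hclosed : ∀ z ∈ U, extDeriv Ω z = 0) {x y : E}
    (hxy : segment ℝ x y ⊆ U) (hker : ∀ z ∈ U, (Ω z).curryLeft (y - x) = 0) : Ω x = Ω y := by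
  have hderiv : ∀ t ∈ Icc (0 : ℝ) 1,
      HasDerivAt (fun t => Ω (AffineMap.lineMap x y t)) 0 t := by
    intro t ht
    have hz : AffineMap.lineMap x y t ∈ U :=
      hxy (segment_eq_image_lineMap ℝ x y ▸ mem_image_of_mem _ ht)
    have h := (hΩ _ hz).hasFDerivAt.comp_hasDerivAt t AffineMap.hasDerivAt_lineMap
    rwa [fderiv_apply_eq_zero_of_extDeriv_eq_zero (hΩ _ hz) (hclosed _ hz)
      (mem_of_superset (hU.mem_nhds hz) hker)] at h
  simpa using (constant_of_has_deriv_right_zero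
    (fun t ht => (hderiv t ht).continuousAt.continuousWithinAt)
    (fun t ht => (hderiv t (Ico_subset_Icc_self ht)).hasDerivWithinAt) 1 (by simp)).symm

end ClosedForms

section Pullbacks

variable {E : Type*} [NormedAddCommGroup E] [NormedSpace ℝ E]
  {M : Type*} [TopologicalSpace M] [ChartedSpace E M]
  {F : Type*} [NormedAddCommGroup F] [NormedSpace ℝ F]
  {N : Type*} [TopologicalSpace N] [ChartedSpace F N] {p : M → N} {n k : ℕ}

/-- `Ω` takes the same values at `x` and at `y` on tuples of tangent vectors with the same images
under the differential of `p`. This is what allows `Ω` to descend along `p`. -/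
def SameValues (F : Type*) [NormedAddCommGroup F] [NormedSpace ℝ F] [ChartedSpace F N]
    (p : M → N) (Ω : DForm E M n k) (x y : M) : Prop :=
  ∀ v w : Fin n → E, (∀ i, mfd E F p x (v i) = mfd E F p y (w i)) → formAt Ω x v = formAt Ω y w

theorem SameValues.symm {Ω : DForm E M n k} {x y : M} (h : SameValues F p Ω x y) :
    SameValues F p Ω y x := fun v w hvw => (h w v fun i => (hvw i).symm).symm

theorem SameValues.trans {Ω : DForm E M n k} {x y z : M} (hxy : SameValues F p Ω x y)
    (hyz : SameValues F p Ω y z) (hsurj : Function.Surjective (mfd E F p y)) :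
    SameValues F p Ω x z := fun v w hvw => by
  choose u hu using fun i => hsurj (mfd E F p x (v i))
  exact (hxy v u fun i => (hu i).symm).trans (hyz u w fun i => (hu i).trans (hvw i))

theorem pullbackForm_injective (hp : Function.Surjective p)
    (hdp : ∀ x, Function.Surjective (mfd E F p x)) :
    Function.Injective (pullbackForm p : DForm F N n k → DForm E M n k) := by
  intro Ω Ω' h
  funext y
  obtain ⟨x, rfl⟩ := hp y
  have hform : formAt Ω (p x) = formAt Ω' (p x) := by
    ext1 u
    choose v hv using fun i => hdp x (u i)
    have hv : u = mfd E F p x ∘ v := funext fun i => (hv i).symm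
    exact hv ▸ DFunLike.congr_fun (congrFun h x) v
  exact hform

theorem exists_pullbackForm_eq [FiniteDimensional ℝ F] {Θ : DForm E M n k}
    (hp : Function.Surjective p) (hdp : ∀ x, Function.Surjective (mfd E F p x))
    (hΘ : ∀ x y, p x = p y → SameValues F p Θ x y) :
    ∃ Ω : DForm F N n k, pullbackForm p Ω = Θ := by
  have hright : ∀ x, ∃ r : F →L[ℝ] E, ∀ u, mfd E F p x (r u) = u := fun x => by
    obtain ⟨r, hr⟩ := LinearMap.exists_rightInverse_of_surjective
      (mfd E F p x : E →ₗ[ℝ] F) (LinearMap.range_eq_top.2 (hdp x))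
    exact ⟨LinearMap.toContinuousLinearMap r, DFunLike.congr_fun hr⟩
  choose r hr using hright
  choose s hs using hp
  let Ω : N → F [⋀^Fin n]→L[ℝ] (Fin k → ℝ) := fun y =>
    (formAt Θ (s y)).compContinuousLinearMap (r (s y))
  refine ⟨Ω, funext fun x => ?_⟩
  have hform : formAt (pullbackForm p Ω) x = formAt Θ x := by
    ext1 v
    exact hΘ _ _ (hs _) _ v fun i => hr _ _
  exact hform

theorem mem_kerForm_iff_curryLeft_eq_zero {Ω : DForm E M (n + 1) k} {x : M} {v : E} :
    v ∈ kerForm Ω x ↔ (formAt Ω x).curryLeft v = 0 :=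
  ⟨fun h => ContinuousAlternatingMap.ext h, DFunLike.congr_fun⟩

theorem mem_kerForm_pullbackForm {Ω : DForm F N (n + 1) k} {x : M} {v : E}
    (h : mfd E F p x v ∈ kerForm Ω (p x)) : v ∈ kerForm (pullbackForm p Ω) x := by
  rw [mem_kerForm_iff_curryLeft_eq_zero] at h ⊢
  ext1 w
  exact map_eq_zero_of_curryLeft_eq_zero (f := formAt Ω (p x)) (i := 0) h

variable [IsManifold 𝓘(ℝ, F) ∞ N]

theorem IsSmoothForm.of_pullbackForm {Ω : DForm F N n k}
    (hp : Manifold.IsSubmersion 𝓘(ℝ, E) 𝓘(ℝ, F) ∞ p) (hsurj : Function.Surjective p)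
    [IsManifold 𝓘(ℝ, E) ∞ M] (hΩ : IsSmoothForm (pullbackForm p Ω : DForm E M n k)) :
    IsSmoothForm Ω := by
  intro y₀ z hz
  set φ := extChartAt 𝓘(ℝ, F) y₀
  obtain ⟨x, hx⟩ := hsurj (φ.symm z)
  obtain ⟨s, -, hs⟩ := exists_local_section hp x
  rw [hx] at hs
  have hφ : ContMDiffAt 𝓘(ℝ, F) 𝓘(ℝ, F) ∞ φ.symm z := contMDiffAt_extChartAt_symm hz
  have hsφ : ContMDiffAt 𝓘(ℝ, F) 𝓘(ℝ, E) ∞ (fun z' => s (φ.symm z')) z :=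
    ContMDiffAt.comp (g := s) z hs.self_of_nhds.2 hφ
  refine ((hΩ.contDiffAt_pullbackForm hsφ).congr_of_eventuallyEq ?_).contDiffWithinAt
  have hsection : ∀ᶠ z' in 𝓝 z, p (s (φ.symm z')) = φ.symm z' :=
    hφ.continuousAt.eventually (hs.mono fun _ h => h.1)
  filter_upwards [hsection.eventually_nhds,
    (contMDiffAt_iff_contMDiffAt_nhds (by simp)).1 (hsφ.of_le (m := 1) (by simp))] with z' heq hz'
  exact (formAt_pullbackForm_congr (heq.mono fun _ h => h.symm) Ω).trans
    (formAt_pullbackForm_comp (hp.contMDiff.mdifferentiableAt (by simp))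
      (hz'.mdifferentiableAt (by simp)) Ω)

theorem IsSmoothForm.dExt_pullbackForm [IsManifold 𝓘(ℝ, E) ∞ M] {Ω : DForm F N n k}
    (hΩ : IsSmoothForm Ω) (hp : ContMDiff 𝓘(ℝ, E) 𝓘(ℝ, F) ∞ p) :
    KContact.dExt (pullbackForm p Ω : DForm E M n k) = pullbackForm p (KContact.dExt Ω) := by
  funext x
  set φ := extChartAt 𝓘(ℝ, E) x with hφ
  have hx := mem_extChartAt_target (I := 𝓘(ℝ, E)) x
  have hpd : MDifferentiable 𝓘(ℝ, E) 𝓘(ℝ, F) p := hp.mdifferentiable (by simp)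
  have hlocal : localRep (pullbackForm p Ω : DForm E M n k) x =ᶠ[𝓝 (φ x)]
      formAt (pullbackForm (fun z => p (φ.symm z)) Ω : DForm E E n k) := by
    filter_upwards [(isOpen_extChartAt_target (I := 𝓘(ℝ, E)) x).mem_nhds hx] with z hz
    exact (formAt_pullbackForm_comp (hpd _)
      ((contMDiffAt_extChartAt_symm hz).mdifferentiableAt (by simp)) Ω).symm
  have hcomp : (fun y => p (φ.symm (φ y))) =ᶠ[𝓝 x] p := by
    filter_upwards [extChartAt_source_mem_nhds (I := 𝓘(ℝ, E)) x] with y hy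
    rw [φ.left_inv hy]
  have hφsymm := contMDiffAt_extChartAt_symm hx
  have hpφ : ContMDiffAt 𝓘(ℝ, E) 𝓘(ℝ, F) ∞ (fun z => p (φ.symm z)) (φ x) :=
    ContMDiffAt.comp (g := p) (φ x) (hp _) hφsymm
  have hform : formAt (KContact.dExt (pullbackForm p Ω : DForm E M n k)) x =
      formAt (pullbackForm p (KContact.dExt Ω)) x := by
    rw [formAt_dExt, ← hφ, hlocal.extDeriv_eq, hΩ.extDeriv_pullbackForm hpφ,
      ← formAt_pullbackForm_congr hcomp, ← formAt_pullbackForm_comp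
        (g := fun z => p (φ.symm z)) (f := φ) (hpφ.mdifferentiableAt (by simp))]
    exact (contMDiffAt_extChartAt_of_mem_source (mem_extChartAt_source x)).mdifferentiableAt
      (by simp)
  exact hform

end Pullbacks

section Descent

variable {E : Type*} [NormedAddCommGroup E] [NormedSpace ℝ E]
  {M : Type*} [TopologicalSpace M] [ChartedSpace E M]
  {F : Type*} [NormedAddCommGroup F] [NormedSpace ℝ F]
  {N : Type*} [TopologicalSpace N] [ChartedSpace F N]
  {K : Type*} [NormedAddCommGroup K] [NormedSpace ℝ K] {p : M → N} {n k : ℕ}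

namespace SubmersionChart

theorem mem_kerForm_pullbackForm_upper_symm (c : SubmersionChart E F K p)
    (hp : MDifferentiable 𝓘(ℝ, E) 𝓘(ℝ, F) p) {Ω : DForm E M (n + 1) k}
    (hker : ∀ x v, mfd E F p x v = 0 → v ∈ kerForm Ω x) {z u : F × K} (hz : z ∈ c.upper.target)
    (hu : u.1 = 0) :
    u ∈ kerForm (pullbackForm c.upper.symm Ω : DForm (F × K) (F × K) (n + 1) k) z := by
  refine mem_kerForm_pullbackForm (hker _ _ ?_)
  refine c.mfd_eq_zero_of_fst_eq_zero (hp _) (c.upper.map_target hz) ?_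
  rw [mfd_mfd_symm c.mdifferentiable_upper hz, hu]

theorem sameValues [IsManifold 𝓘(ℝ, E) ∞ M] (c : SubmersionChart E F K p)
    (hp : MDifferentiable 𝓘(ℝ, E) 𝓘(ℝ, F) p) {Ω : DForm E M (n + 1) k} (hΩ : IsSmoothForm Ω)
    (hclosed : dExt Ω = 0) (hker : ∀ x v, mfd E F p x v = 0 → v ∈ kerForm Ω x) {x y : M}
    (hx : x ∈ c.upper.source) (hy : y ∈ c.upper.source) (hpxy : p x = p y)
    (hseg : segment ℝ (c.upper x) (c.upper y) ⊆ c.upper.target) : SameValues F p Ω x y := by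
  set Ω' := formAt (pullbackForm c.upper.symm Ω : DForm (F × K) (F × K) (n + 1) k)
  have hvertical : ∀ z ∈ c.upper.target, ∀ u : F × K, u.1 = 0 → (Ω' z).curryLeft u = 0 :=
    fun z hz u hu => mem_kerForm_iff_curryLeft_eq_zero.1
      (c.mem_kerForm_pullbackForm_upper_symm hp hker hz hu)
  have hfst : (c.upper y - c.upper x).1 = 0 := by
    rw [Prod.fst_sub, ← c.lower_apply hx, ← c.lower_apply hy, hpxy, sub_self]
  have hconst : Ω' (c.upper x) = Ω' (c.upper y) := by
    refine eq_of_extDeriv_eq_zero c.upper.open_target (fun z hz => ?_) (fun z hz => ?_) hseg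
      fun z hz => hvertical z hz _ hfst
    · exact (hΩ.contDiffAt_pullbackForm (c.contMDiffAt_upper_symm hz)).differentiableAt (by simp)
    · rw [hΩ.extDeriv_pullbackForm (c.contMDiffAt_upper_symm hz), hclosed]
      rfl
  have hpull : ∀ {q}, q ∈ c.upper.source → ∀ v : Fin (n + 1) → E,
      Ω' (c.upper q) (fun i => mfd E (F × K) c.upper q (v i)) = formAt Ω q v := by
    intro q hq v
    change formAt Ω (c.upper.symm (c.upper q))
      (fun i => mfd (F × K) E c.upper.symm (c.upper q) (mfd E (F × K) c.upper q (v i))) = _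
    simp only [mfd_symm_mfd c.mdifferentiable_upper hq, c.upper.left_inv hq]
  intro v w hvw
  rw [← hpull hx, ← hpull hy, hconst]
  refine map_eq_map_of_curryLeft_sub_eq_zero fun i => hvertical _ (c.upper.map_source hy) _ ?_
  rw [Prod.fst_sub, ← c.mfd_lower_mfd (hp _) hx, ← c.mfd_lower_mfd (hp _) hy, hvw i, hpxy,
    sub_self]

end SubmersionChart

end Descent

section LeafForm

variable {E : Type*} [NormedAddCommGroup E] [NormedSpace ℝ E]
  {M : Type*} [TopologicalSpace M] [ChartedSpace E M] {k : ℕ} {η : DForm E M 1 k}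

theorem IsReebCurve.comp_mul_left {γ : ℝ → M} (hγ : IsReebCurve η γ) (t : ℝ) :
    IsReebCurve η (fun s => γ (t * s)) where
  contMDiff := hγ.contMDiff.comp (contDiff_const.mul contDiff_id).contMDiff
  mem_kerForm s := by
    have hvelocity : mfd ℝ E (fun s => γ (t * s)) s 1 = t • mfd ℝ E γ (t * s) 1 := by
      rw [mfd_comp_apply (g := γ) (f := fun s => t * s)
        (hγ.contMDiff.mdifferentiableAt (by simp))
        (differentiableAt_id.const_mul t).mdifferentiableAt, mfd_eq_fderiv, ← map_smul]
      simp
    exact hvelocity ▸ (kerForm (dExt η) (γ (t * s))).smul_mem t (hγ.mem_kerForm (t * s))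

theorem IsReebCurve.leafProj_eq_zero {γ : ℝ → M} (hγ : IsReebCurve η γ) (t : ℝ) :
    leafProj η (γ t) = leafProj η (γ 0) := by
  simpa using (hγ.comp_mul_left t).leafProj_eq.symm

theorem leafProj_surjective (η : DForm E M 1 k) : Function.Surjective (leafProj η) :=
  Quotient.mk_surjective

variable [FiniteDimensional ℝ E] [IsManifold 𝓘(ℝ, E) ∞ M] [T2Space M]
  {F : Type*} [NormedAddCommGroup F] [NormedSpace ℝ F] [ChartedSpace F (LeafSpace η)]

namespace IsKContactForm

variable (hη : IsKContactForm η) (hp : Manifold.IsSubmersion 𝓘(ℝ, E) 𝓘(ℝ, F) ∞ (leafProj η))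
include hη hp

theorem mem_kerForm_dExt_iff {x : M} {v : E} :
    v ∈ kerForm (dExt η) x ↔ mfd E F (leafProj η) x v = 0 :=
  mem_kerForm_two.trans (hη.mfd_leafProj_eq_zero_iff hp).symm

theorem sameValues_dExt_of_isReebCurve {γ : ℝ → M} (hγ : IsReebCurve η γ) :
    SameValues F (leafProj η) (dExt η) (γ 0) (γ 1) := by
  refine isPreconnected_univ.induction₂
    (fun s t => SameValues F (leafProj η) (dExt η) (γ s) (γ t)) (fun t _ => ?_)
    (fun _ b _ _ _ _ hab hbc => hab.trans hbc (surjective_mfd_of_isSubmersion hp _))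
    (fun _ _ _ _ hab => hab.symm) (mem_univ 0) (mem_univ 1)
  rw [nhdsWithin_univ]
  obtain ⟨c, hc⟩ := exists_submersionChart (hp.isSubmersionOfComplement_complement (γ t))
  obtain ⟨r, hr, hball⟩ := Metric.isOpen_iff.1 c.upper.open_target _ (c.upper.map_source hc)
  have hγt : ContinuousAt γ t := hγ.contMDiff.continuous.continuousAt
  have hupper : ContinuousAt (fun s => c.upper (γ s)) t :=
    ContinuousAt.comp (g := c.upper) (c.contMDiffAt_upper hc).continuousAt hγt
  filter_upwards [hγt (c.upper.open_source.mem_nhds hc), hupper (ball_mem_nhds _ hr)]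
    with s hs hsball
  refine c.sameValues (hp.contMDiff.mdifferentiable (by simp)) hη.smooth.dExt hη.smooth.dExt_dExt
    (fun x v hv => (hη.mem_kerForm_dExt_iff hp).2 hv) hc hs ?_
    (((convex_ball _ r).segment_subset (mem_ball_self hr) hsball).trans hball)
  rw [hγ.leafProj_eq_zero t, hγ.leafProj_eq_zero s]

theorem sameValues_dExt {x y : M} (h : leafProj η x = leafProj η y) :
    SameValues F (leafProj η) (dExt η) x y := by
  have hsurj := surjective_mfd_of_isSubmersion hp
  refine (iff_of_leafProj_eq (p := fun z => SameValues F (leafProj η) (dExt η) x z)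
    (fun γ hγ => ?_) h).1 fun v w hvw => ?_
  · have hγ' := hη.sameValues_dExt_of_isReebCurve hp hγ
    exact ⟨fun h => h.trans hγ' (hsurj _), fun h => h.trans hγ'.symm (hsurj _)⟩
  · refine map_eq_map_of_curryLeft_sub_eq_zero fun i => mem_kerForm_iff_curryLeft_eq_zero.1
      ((hη.mem_kerForm_dExt_iff hp).2 ?_)
    rw [map_sub, hvw i, sub_self]

theorem isKSymplecticForm [IsManifold 𝓘(ℝ, F) ∞ (LeafSpace η)] {Ω : DForm F (LeafSpace η) 2 k}
    (hΩ : pullbackForm (leafProj η) Ω = dExt η) : IsKSymplecticForm Ω := by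
  have hsurj := leafProj_surjective η
  have hdsurj := surjective_mfd_of_isSubmersion hp
  have hsmooth : IsSmoothForm Ω := .of_pullbackForm hp hsurj (hΩ ▸ hη.smooth.dExt)
  refine ⟨hsmooth, pullbackForm_injective hsurj hdsurj ?_, fun y => ?_⟩
  · rw [← hsmooth.dExt_pullbackForm hp.contMDiff, hΩ, hη.smooth.dExt_dExt]
    rfl
  · obtain ⟨x, rfl⟩ := hsurj y
    refine (Submodule.eq_bot_iff _).2 fun u hu => ?_
    obtain ⟨v, rfl⟩ := hdsurj x u
    exact (hη.mem_kerForm_dExt_iff hp).1 (hΩ ▸ mem_kerForm_pullbackForm hu)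

end IsKContactForm

end LeafForm

section Extension

variable {E : Type*} [NormedAddCommGroup E] [NormedSpace ℝ E] [FiniteDimensional ℝ E]
  {M : Type*} [TopologicalSpace M] [ChartedSpace E M] [IsManifold 𝓘(ℝ, E) ∞ M] {k : ℕ}
  {η : DForm E M 1 k}

theorem exists_isSmoothVF_apply_eq [T2Space M] (x : M) (v : E) :
    ∃ V : VField E M, IsSmoothVF V ∧ vecAt V x = v := by
  have : IsManifold 𝓘(ℝ, E) (∞ + 1) M := by simpa
  let σ₀ : TangentSpace 𝓘(ℝ, E) x := v
  obtain ⟨s, hs, hsmooth⟩ := FiberBundle.exists_contMDiffOn_extend (k := ∞) 𝓘(ℝ, E) E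
    (V := fun x : M => TangentSpace 𝓘(ℝ, E) x) σ₀
  obtain ⟨u, hus, hu, hxu⟩ := mem_nhds_iff.1 hs
  obtain ⟨f, -, hfu⟩ :=
    (SmoothBumpFunction.nhds_basis_tsupport (I := 𝓘(ℝ, E)) x).mem_iff.1 (hu.mem_nhds hxu)
  refine ⟨(f : M → ℝ) • FiberBundle.extend E σ₀, ContMDiffOn.smul_section_of_tsupport
    f.contMDiff.contMDiffOn hu hfu (hsmooth.mono hus), ?_⟩
  change f x • FiberBundle.extend E σ₀ x = σ₀
  rw [f.eq_one, FiberBundle.extend_apply_self, one_smul]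

theorem IsSmoothForm.contDiffAt_localRep_localRepVF (hη : IsSmoothForm η) {Y : VField E M}
    (hY : IsSmoothVF Y) {x₀ : M} {y : E} (hy : y ∈ (extChartAt 𝓘(ℝ, E) x₀).target) :
    ContDiffAt ℝ ∞ (fun y => localRep η x₀ y ![localRepVF Y x₀ y]) y := by
  simpa only [Function.comp_apply, oneFormCLM_apply] using (oneFormCLM.contDiff.contDiffAt.comp y
    (hη.contDiffAt_localRep hy)).clm_apply (hY.contDiffAt_localRepVF hy)

omit [FiniteDimensional ℝ E] in
theorem localRep_localRepVF (η : DForm E M 1 k) (Y : VField E M) {x₀ x : M}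
    (hx : x ∈ (extChartAt 𝓘(ℝ, E) x₀).source) :
    localRep η x₀ (extChartAt 𝓘(ℝ, E) x₀ x) ![localRepVF Y x₀ (extChartAt 𝓘(ℝ, E) x₀ x)] =
      formAt η x ![vecAt Y x] := by
  have hx' := (extChartAt 𝓘(ℝ, E) x₀).map_source hx
  rw [localRep_apply_one, mfd_extChartAt_symm_localRepVF Y hx', (extChartAt 𝓘(ℝ, E) x₀).left_inv hx]

omit [FiniteDimensional ℝ E] in
theorem formAt_apply_eventuallyEq (η : DForm E M 1 k) (Y : VField E M) (x₀ : M) :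
    (fun x => formAt η x ![vecAt Y x]) =ᶠ[𝓝 x₀]
      (fun y => localRep η x₀ y ![localRepVF Y x₀ y]) ∘ extChartAt 𝓘(ℝ, E) x₀ := by
  filter_upwards [extChartAt_source_mem_nhds (I := 𝓘(ℝ, E)) x₀] with x hx
  exact (localRep_localRepVF η Y hx).symm

theorem IsSmoothForm.contMDiff_apply (hη : IsSmoothForm η) {Y : VField E M} (hY : IsSmoothVF Y) :
    ContMDiff 𝓘(ℝ, E) 𝓘(ℝ, Fin k → ℝ) ∞ (fun x => formAt η x ![vecAt Y x]) := fun x =>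
  ((hη.contDiffAt_localRep_localRepVF hY (mem_extChartAt_target x)).contMDiffAt.comp x
    (contMDiffAt_extChartAt_of_mem_source (mem_extChartAt_source x))).congr_of_eventuallyEq
      (formAt_apply_eventuallyEq η Y x)

theorem IsKContactForm.exists_section_ker [T2Space M] (hη : IsKContactForm η) {x : M} {v : E}
    (hv : formAt η x ![v] = 0) :
    ∃ Z : VField E M, IsSmoothVF Z ∧ (∀ y, formAt η y ![vecAt Z y] = 0) ∧ vecAt Z x = v := by
  have : IsManifold 𝓘(ℝ, E) (∞ + 1) M := by simpa
  obtain ⟨V, hV, rfl⟩ := exists_isSmoothVF_apply_eq x v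
  refine ⟨fun y => vecAt V y - hη.reeb y (formAt η y ![vecAt V y]),
    ContMDiff.sub_section hV (hη.isSmoothVF_reeb (hη.smooth.contMDiff_apply hV)), fun y => ?_, ?_⟩
  · change formAt η y ![vecAt V y - hη.reeb y (formAt η y ![vecAt V y])] = 0
    rw [← oneFormCLM_apply, map_sub, oneFormCLM_apply, oneFormCLM_apply, hη.formAt_reeb, sub_self]
  · change vecAt V x - hη.reeb x (formAt η x ![vecAt V x]) = vecAt V x
    rw [hv, map_zero, sub_zero]

end Extension

section Hamiltonian

variable {E : Type*} [NormedAddCommGroup E] [NormedSpace ℝ E] [FiniteDimensional ℝ E]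
  {M : Type*} [TopologicalSpace M] [ChartedSpace E M] [IsManifold 𝓘(ℝ, E) ∞ M] {k : ℕ}
  {η : DForm E M 1 k} {Y : VField E M}

theorem mfd_hamFun (hη : IsSmoothForm η) (hY : IsSmoothVF Y) (x : M) :
    mfd E (Fin k → ℝ) (hamFun η Y) x =
      -fderiv ℝ (fun y => localRep η x y ![localRepVF Y x y]) (extChartAt 𝓘(ℝ, E) x x) := by
  have hlocal := hη.contDiffAt_localRep_localRepVF hY (mem_extChartAt_target (I := 𝓘(ℝ, E)) x)
  have hchart : MDifferentiableAt 𝓘(ℝ, E) 𝓘(ℝ, E) (extChartAt 𝓘(ℝ, E) x) x :=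
    mdifferentiableAt_extChartAt (mem_chart_source E x)
  rw [mfd_congr (f := hamFun η Y) (g := fun z => -localRep η x (extChartAt 𝓘(ℝ, E) x z)
      ![localRepVF Y x (extChartAt 𝓘(ℝ, E) x z)]) (formAt_apply_eventuallyEq η Y x).neg,
    mfd_comp (g := fun y => -localRep η x y ![localRepVF Y x y])
      (hlocal.neg.contMDiffAt.mdifferentiableAt (by simp)) hchart,
    mfd_extChartAt_self, mfd_eq_fderiv, fderiv_fun_neg, ContinuousLinearMap.comp_id]

omit [FiniteDimensional ℝ E] in
theorem localRepVF_self (Y : VField E M) (x : M) :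
    localRepVF Y x (extChartAt 𝓘(ℝ, E) x x) = vecAt Y x := by
  rw [← mfd_extChartAt_apply_eq_localRepVF Y (mem_extChartAt_source x), mfd_extChartAt_self]
  rfl

/-- Cartan's formula for `dη(Y, Z)`, where `Z` extends `v` to a section of `ker η`: two of its three
terms vanish because `Y` is a symmetry of `ker η`. -/
theorem IsEtaHamiltonian.dExt_apply_of_mem_ker [T2Space M] (hη : IsKContactForm η)
    (hY : IsEtaHamiltonian η Y) {x : M} {v : E} (hv : formAt η x ![v] = 0) :
    formAt (dExt η) x ![vecAt Y x, v] = mfd E (Fin k → ℝ) (hamFun η Y) x v := by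
  obtain ⟨Z, hZ, hZη, rfl⟩ := hη.exists_section_ker hv
  have hx := mem_extChartAt_target (I := 𝓘(ℝ, E)) x
  have hcartan := extDeriv_one_form_apply
    ((hη.smooth.contDiffAt_localRep hx).differentiableAt (by simp))
    ((hY.smooth.contDiffAt_localRepVF hx).differentiableAt (by simp))
    ((hZ.contDiffAt_localRepVF hx).differentiableAt (by simp))
  have hηZ : (fun y => localRep η x y ![localRepVF Z x y]) =ᶠ[𝓝 (extChartAt 𝓘(ℝ, E) x x)]
      fun _ => 0 := by
    filter_upwards [(isOpen_extChartAt_target (I := 𝓘(ℝ, E)) x).mem_nhds hx] with y hy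
    rw [localRep_apply_one, mfd_extChartAt_symm_localRepVF Z hy, hZη]
  have hlie := hY.lie_symm Z hZ (fun y => (mem_kerForm_one (E := E)).2 (hZη y)) x
  rw [mlieBracket_eq_lieBracket_localRepVF] at hlie
  rwa [← hη.smooth.localRep_dExt hx, localRepVF_self, localRepVF_self, localRep_self_apply_two,
    localRep_self_apply_one, (mem_kerForm_one (E := E)).1 hlie, hηZ.fderiv_eq, fderiv_fun_const,
    Pi.zero_apply, zero_apply, zero_sub, sub_zero, ← neg_apply,
    ← mfd_hamFun hη.smooth hY.smooth] at hcartan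

theorem IsEtaHamiltonian.dExt_apply [T2Space M] (hη : IsKContactForm η)
    (hY : IsEtaHamiltonian η Y)
    (hR : ∀ R : Fin k → VField E M, IsReebFamily η R →
      ∀ α x, mvfderiv 𝓘(ℝ, E) (hamFun η Y) x (R α x) = 0) (x : M) (v : E) :
    formAt (dExt η) x ![vecAt Y x, v] = mfd E (Fin k → ℝ) (hamFun η Y) x v := by
  have hreeb : (mfd E (Fin k → ℝ) (hamFun η Y) x).comp (hη.reeb x) = 0 :=
    ContinuousLinearMap.coe_injective <| LinearMap.pi_ext' fun α =>
      LinearMap.ext_ring (hR _ hη.isReebFamily α x)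
  set w := formAt η x ![v]
  have hker : formAt η x ![v - hη.reeb x w] = 0 := by
    rw [← oneFormCLM_apply, map_sub, oneFormCLM_apply, oneFormCLM_apply, hη.formAt_reeb, sub_self]
  have hmain := hY.dExt_apply_of_mem_ker hη hker
  rwa [map_sub, ← ContinuousLinearMap.comp_apply, hreeb, zero_apply, sub_zero, ← twoFormCLM_apply,
    map_sub, twoFormCLM_apply, twoFormCLM_apply, two_form_swap _ _ (hη.reeb x w),
    hη.formAt_dExt_reeb, neg_zero, sub_zero] at hmain

omit [FiniteDimensional ℝ E] [IsManifold 𝓘(ℝ, E) ∞ M] in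
theorem eq_of_leafProj_eq {G : Type*} [NormedAddCommGroup G] [NormedSpace ℝ G] {h : M → G}
    (hh : MDifferentiable 𝓘(ℝ, E) 𝓘(ℝ, G) h)
    (hdh : ∀ x, ∀ v ∈ kerForm (dExt η) x, mfd E G h x v = 0) {x y : M}
    (hxy : leafProj η x = leafProj η y) : h x = h y := by
  refine (iff_of_leafProj_eq (p := fun z => h x = h z) (fun γ hγ => ?_) hxy).1 rfl
  have hγdiff := hγ.contMDiff.mdifferentiable one_ne_zero
  suffices hconst : h (γ 0) = h (γ 1) by rw [hconst]
  refine is_const_of_deriv_eq_zero (f := h ∘ γ)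
    (fun t => ((hh _).comp t (hγdiff t)).differentiableAt) (fun t => ?_) 0 1
  have hchain := mfd_comp_apply (hh _) (hγdiff t) (1 : ℝ)
  rw [mfd_eq_fderiv] at hchain
  exact hchain.trans (hdh _ _ (hγ.mem_kerForm t))

end Hamiltonian

section Related

theorem fderiv_apply_lieBracket_of_related {V W : Type*} [NormedAddCommGroup V] [NormedSpace ℝ V]
    [NormedAddCommGroup W] [NormedSpace ℝ W] {f : V → W} {Y Z : V → V} {Y' Z' : W → W} {x : V}
    (hf : ContDiffAt ℝ ∞ f x) (hY : DifferentiableAt ℝ Y x) (hZ : DifferentiableAt ℝ Z x)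
    (hY' : DifferentiableAt ℝ Y' (f x)) (hZ' : DifferentiableAt ℝ Z' (f x))
    (hYY' : (fun y => fderiv ℝ f y (Y y)) =ᶠ[𝓝 x] fun y => Y' (f y))
    (hZZ' : (fun y => fderiv ℝ f y (Z y)) =ᶠ[𝓝 x] fun y => Z' (f y)) :
    fderiv ℝ f x (VectorField.lieBracket ℝ Y Z x) = VectorField.lieBracket ℝ Y' Z' (f x) := by
  have hfx : DifferentiableAt ℝ f x := hf.differentiableAt (by simp)
  rw [VectorField.fderiv_apply_lieBracket hf
      (by rw [minSmoothness_of_isRCLikeNormedField]; exact two_le_infty) hZ hY,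
    hYY'.fderiv_eq, hZZ'.fderiv_eq, fderiv_fun_comp x hY' hfx, fderiv_fun_comp x hZ' hfx,
    ContinuousLinearMap.comp_apply, ContinuousLinearMap.comp_apply, hYY'.eq_of_nhds,
    hZZ'.eq_of_nhds]
  rfl

variable {E : Type*} [NormedAddCommGroup E] [NormedSpace ℝ E]
  {M : Type*} [TopologicalSpace M] [ChartedSpace E M]
  {F : Type*} [NormedAddCommGroup F] [NormedSpace ℝ F]
  {N : Type*} [TopologicalSpace N] [ChartedSpace F N] {p : M → N} {k : ℕ}
  {Y Z : VField E M} {Y' Z' : VField F N}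

/-- The vector fields `Y` and `Y'` are `p`-related. -/
def Related (p : M → N) (Y : VField E M) (Y' : VField F N) : Prop :=
  ∀ x, mfd E F p x (vecAt Y x) = vecAt Y' (p x)

theorem Related.unique {Y'' : VField F N} (hsurj : Function.Surjective p) (h : Related p Y Y')
    (h' : Related p Y Y'') : Y' = Y'' := by
  funext y
  obtain ⟨x, rfl⟩ := hsurj y
  exact (h x).symm.trans (h' x)

theorem exists_linearMap_related (hsurj : Function.Surjective p) {V : Submodule ℝ (VField E M)}
    (h : ∀ Y ∈ V, ∃ Y' : VField F N, Related p Y Y') :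
    ∃ L : VField E M →ₗ[ℝ] VField F N, ∀ Y ∈ V, Related p Y (L Y) := by
  choose s hs using hsurj
  let L : (M → E) →ₗ[ℝ] (N → F) :=
    LinearMap.pi fun y => (mfd E F p (s y)).toLinearMap ∘ₗ LinearMap.proj (s y)
  refine ⟨L, fun Y hY x => ?_⟩
  obtain ⟨Y', hYY'⟩ := h Y hY
  have hvalue := hYY' (s (p x))
  rw [hs] at hvalue
  exact (hYY' x).trans hvalue.symm

theorem contDiffAt_writtenInExtChartAt {x : M}
    (hp : ContMDiffAt 𝓘(ℝ, E) 𝓘(ℝ, F) ∞ p x) :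
    ContDiffAt ℝ ∞ (writtenInExtChartAt 𝓘(ℝ, E) 𝓘(ℝ, F) x p) (extChartAt 𝓘(ℝ, E) x x) := by
  have h := (contMDiffAt_iff.1 hp).2
  rwa [modelWithCornersSelf_coe, range_id, contDiffWithinAt_univ] at h

theorem fderiv_writtenInExtChartAt {x : M} (hp : MDifferentiableAt 𝓘(ℝ, E) 𝓘(ℝ, F) p x) :
    fderiv ℝ (writtenInExtChartAt 𝓘(ℝ, E) 𝓘(ℝ, F) x p) (extChartAt 𝓘(ℝ, E) x x) =
      mfd E F p x := by
  rw [mfd, hp.mfderiv, modelWithCornersSelf_coe, range_id, fderivWithin_univ]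

theorem Related.fderiv_writtenInExtChartAt_eventuallyEq [IsManifold 𝓘(ℝ, E) ∞ M]
    [IsManifold 𝓘(ℝ, F) ∞ N] (hp : MDifferentiable 𝓘(ℝ, E) 𝓘(ℝ, F) p) (h : Related p Y Y')
    (x : M) :
    (fun z => fderiv ℝ (writtenInExtChartAt 𝓘(ℝ, E) 𝓘(ℝ, F) x p) z (localRepVF Y x z))
      =ᶠ[𝓝 (extChartAt 𝓘(ℝ, E) x x)]
      fun z => localRepVF Y' (p x) (writtenInExtChartAt 𝓘(ℝ, E) 𝓘(ℝ, F) x p z) := by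
  have hx := mem_extChartAt_target (I := 𝓘(ℝ, E)) x
  have hcontinuous : ContinuousAt (fun z => p ((extChartAt 𝓘(ℝ, E) x).symm z))
      (extChartAt 𝓘(ℝ, E) x x) :=
    (hp _).continuousAt.comp (continuousAt_extChartAt_symm x)
  have hsource : (extChartAt 𝓘(ℝ, F) (p x)).source ∈
      𝓝 (p ((extChartAt 𝓘(ℝ, E) x).symm (extChartAt 𝓘(ℝ, E) x x))) := by
    rw [extChartAt_to_inv]
    exact extChartAt_source_mem_nhds (p x)
  filter_upwards [(isOpen_extChartAt_target x).mem_nhds hx, hcontinuous hsource] with z hz hpz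
  have hsymm := (contMDiffAt_extChartAt_symm hz).mdifferentiableAt (n := ∞) (by simp)
  rw [← mfd_eq_fderiv]
  change mfd E F (fun z => extChartAt 𝓘(ℝ, F) (p x) (p ((extChartAt 𝓘(ℝ, E) x).symm z))) z _ = _
  rw [mfd_comp_apply (g := extChartAt 𝓘(ℝ, F) (p x))
      (f := fun z => p ((extChartAt 𝓘(ℝ, E) x).symm z))
      ((contMDiffAt_extChartAt_of_mem_source hpz).mdifferentiableAt (n := ∞) (by simp))
      (MDifferentiableAt.comp (g := p) z (hp _) hsymm),
    mfd_comp_apply (g := p) (hp _) hsymm, mfd_extChartAt_symm_localRepVF Y hz, h,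
    mfd_extChartAt_apply_eq_localRepVF Y' hpz]
  rfl

variable [IsManifold 𝓘(ℝ, E) ∞ M] [IsManifold 𝓘(ℝ, F) ∞ N]

theorem Related.mlieBracket [CompleteSpace E] [CompleteSpace F]
    (hp : ContMDiff 𝓘(ℝ, E) 𝓘(ℝ, F) ∞ p) (hY : IsSmoothVF Y) (hZ : IsSmoothVF Z)
    (hY' : IsSmoothVF Y') (hZ' : IsSmoothVF Z') (hYY' : Related p Y Y') (hZZ' : Related p Z Z') :
    Related p (VectorField.mlieBracket 𝓘(ℝ, E) Y Z)
      (VectorField.mlieBracket 𝓘(ℝ, F) Y' Z') := fun x => by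
  have hpdiff : MDifferentiable 𝓘(ℝ, E) 𝓘(ℝ, F) p := hp.mdifferentiable (by simp)
  have hcentre : writtenInExtChartAt 𝓘(ℝ, E) 𝓘(ℝ, F) x p (extChartAt 𝓘(ℝ, E) x x) =
      extChartAt 𝓘(ℝ, F) (p x) (p x) := by
    rw [writtenInExtChartAt, Function.comp_apply, Function.comp_apply, extChartAt_to_inv]
  have hbase {A : VField E M} (hA : IsSmoothVF A) :
      DifferentiableAt ℝ (localRepVF A x) (extChartAt 𝓘(ℝ, E) x x) :=
    (hA.contDiffAt_localRepVF (mem_extChartAt_target x)).differentiableAt (by simp)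
  have htarget {A' : VField F N} (hA' : IsSmoothVF A') :
      DifferentiableAt ℝ (localRepVF A' (p x))
        (writtenInExtChartAt 𝓘(ℝ, E) 𝓘(ℝ, F) x p (extChartAt 𝓘(ℝ, E) x x)) :=
    hcentre ▸ (hA'.contDiffAt_localRepVF (mem_extChartAt_target _)).differentiableAt (by simp)
  have hbracket := fderiv_apply_lieBracket_of_related (contDiffAt_writtenInExtChartAt (hp x))
    (hbase hY) (hbase hZ) (htarget hY') (htarget hZ')
    (hYY'.fderiv_writtenInExtChartAt_eventuallyEq hpdiff x)
    (hZZ'.fderiv_writtenInExtChartAt_eventuallyEq hpdiff x)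
  rwa [hcentre, fderiv_writtenInExtChartAt (hpdiff x), ← mlieBracket_eq_lieBracket_localRepVF,
    ← mlieBracket_eq_lieBracket_localRepVF] at hbracket

end Related

section Descent

variable {E : Type*} [NormedAddCommGroup E] [NormedSpace ℝ E]
  {M : Type*} [TopologicalSpace M] [ChartedSpace E M]
  {F : Type*} [NormedAddCommGroup F] [NormedSpace ℝ F]
  {N : Type*} [TopologicalSpace N] [ChartedSpace F N] {p : M → N}

theorem exists_related_of_pullbackForm {k : ℕ} {Ω : DForm F N 2 k} {Y : VField E M}
    {β : N → F →L[ℝ] (Fin k → ℝ)} (hsurj : Function.Surjective p)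
    (hdsurj : ∀ x, Function.Surjective (mfd E F p x)) (hΩ : ∀ y, kerForm Ω y = ⊥)
    (hβ : ∀ x v, formAt (pullbackForm p Ω) x ![vecAt Y x, v] = β (p x) (mfd E F p x v)) :
    ∃ Y' : VField F N, Related p Y Y' ∧ ∀ y u, formAt Ω y ![vecAt Y' y, u] = β y u := by
  have himage : ∀ x u, formAt Ω (p x) ![mfd E F p x (vecAt Y x), u] = β (p x) u := fun x u => by
    obtain ⟨v, rfl⟩ := hdsurj x u
    rw [← formAt_pullbackForm_two, hβ]
  choose s hs using hsurj
  let Y' : N → F := fun y => mfd E F p (s y) (vecAt Y (s y))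
  have hY' : ∀ y u, formAt Ω y ![vecAt Y' y, u] = β y u := fun y u => by
    have h := himage (s y) u
    rwa [hs] at h
  refine ⟨Y', fun x => sub_eq_zero.1 ((Submodule.eq_bot_iff _).1 (hΩ (p x)) _ ?_), hY'⟩
  refine (mem_kerForm_two (E := F)).2 fun u => ?_
  rw [← twoFormCLM_apply, map_sub, sub_apply, twoFormCLM_apply, twoFormCLM_apply, himage, hY',
    sub_self]

variable (hp : Manifold.IsSubmersion 𝓘(ℝ, E) 𝓘(ℝ, F) ∞ p)
  (hsurj : Function.Surjective p)
include hp hsurj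

theorem exists_contMDiff_comp_eq {G : Type*} [NormedAddCommGroup G] [NormedSpace ℝ G]
    {h : M → G} (hh : ContMDiff 𝓘(ℝ, E) 𝓘(ℝ, G) ∞ h) (hconst : ∀ x y, p x = p y → h x = h y) :
    ∃ g : N → G, ContMDiff 𝓘(ℝ, F) 𝓘(ℝ, G) ∞ g ∧ ∀ x, g (p x) = h x := by
  obtain ⟨g, rfl⟩ : ∃ g : N → G, h = g ∘ p :=
    (Function.factorsThrough_iff h).1 hconst
  refine ⟨g, fun y => ?_, fun _ => rfl⟩
  obtain ⟨x, rfl⟩ := hsurj y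
  obtain ⟨s, -, hs⟩ := exists_local_section hp x
  refine ((hh _).comp (p x) hs.self_of_nhds.2).congr_of_eventuallyEq ?_
  filter_upwards [hs] with y hy
  exact congrArg g hy.1.symm

variable [IsManifold 𝓘(ℝ, E) ∞ M] [IsManifold 𝓘(ℝ, F) ∞ N]

theorem IsJointlySmooth.of_related {X : ℝ → VField E M} {X' : ℝ → VField F N}
    (hX : IsJointlySmooth X) (h : ∀ t, Related p (X t) (X' t)) : IsJointlySmooth X' := by
  rintro ⟨t, y⟩
  obtain ⟨x, rfl⟩ := hsurj y
  obtain ⟨s, -, hs⟩ := exists_local_section hp x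
  have hsection : ContMDiffAt (𝓘(ℝ, ℝ).prod 𝓘(ℝ, F)) (𝓘(ℝ, ℝ).prod 𝓘(ℝ, E)) ∞
      (fun q : ℝ × N => (q.1, s q.2)) (t, p x) :=
    contMDiffAt_fst.prodMk (ContMDiffAt.comp (g := s) (t, p x) hs.self_of_nhds.2 contMDiffAt_snd)
  have htangent := hp.contMDiff.contMDiff_tangentMap (m := ∞) (by simp)
  refine ((htangent _).comp (t, p x)
    (ContMDiffAt.comp (t, p x) (hX (t, s (p x))) hsection)).congr_of_eventuallyEq ?_
  filter_upwards [continuousAt_snd.eventually hs] with q hq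
  have hvalue : (⟨p (s q.2), X' q.1 (p (s q.2))⟩ : TangentBundle 𝓘(ℝ, F) N) =
      tangentMap 𝓘(ℝ, E) 𝓘(ℝ, F) p ⟨s q.2, X q.1 (s q.2)⟩ :=
    congrArg (fun u => (⟨p (s q.2), u⟩ : TangentBundle 𝓘(ℝ, F) N)) (h q.1 (s q.2)).symm
  rwa [hq.1] at hvalue

theorem IsSmoothVF.of_related {Y : VField E M} {Y' : VField F N} (hY : IsSmoothVF Y)
    (h : Related p Y Y') : IsSmoothVF Y' := by
  have hconst : IsJointlySmooth (fun _ : ℝ => Y) := ContMDiff.comp hY contMDiff_snd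
  exact ContMDiff.comp (hconst.of_related hp hsurj (X' := fun _ => Y') fun _ => h)
    (contMDiff_const.prodMk contMDiff_id : ContMDiff _ _ _ fun y : N => ((0 : ℝ), y))

theorem IsVessiotGuldberg.map [CompleteSpace E] [CompleteSpace F] {X : ℝ → VField E M}
    {V : Submodule ℝ (VField E M)} (hV : IsVessiotGuldberg X V)
    {L : VField E M →ₗ[ℝ] VField F N} (hL : ∀ Y ∈ V, Related p Y (L Y)) :
    IsVessiotGuldberg (fun t => L (X t)) (V.map L) := by
  have := hV.finiteDimensional
  have hsmooth : ∀ Y ∈ V, IsSmoothVF Y := hV.lieAlgebra.smooth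
  have hsmooth' : ∀ Y ∈ V, IsSmoothVF (L Y) := fun Y hY =>
    (hsmooth Y hY).of_related hp hsurj (hL Y hY)
  refine ⟨⟨?_, ?_⟩, inferInstance, fun t => Submodule.mem_map_of_mem (hV.mem t)⟩
  · rintro _ ⟨Y, hY, rfl⟩
    exact hsmooth' Y hY
  · rintro _ ⟨Y, hY, rfl⟩ _ ⟨Z, hZ, rfl⟩
    have hYZ := hV.lieAlgebra.lie_mem Y hY Z hZ
    exact ⟨_, hYZ, (hL _ hYZ).unique hsurj (Related.mlieBracket hp.contMDiff (hsmooth Y hY)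
      (hsmooth Z hZ) (hsmooth' Y hY) (hsmooth' Z hZ) (hL Y hY) (hL Z hZ))⟩

end Descent

section LieSystems

variable {E : Type*} [NormedAddCommGroup E] [NormedSpace ℝ E]
  {M : Type*} [TopologicalSpace M] [ChartedSpace E M] [IsManifold 𝓘(ℝ, E) ∞ M]

theorem IsLieSystem.isVessiotGuldberg_smallestLieAlgebra {X : ℝ → VField E M}
    (hX : IsLieSystem X) : IsVessiotGuldberg X (smallestLieAlgebra X) := by
  obtain ⟨V, hV⟩ := hX
  have hle : smallestLieAlgebra X ≤ V := sInf_le ⟨hV.lieAlgebra, hV.mem⟩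
  have := hV.finiteDimensional
  refine ⟨⟨fun Y hY => hV.lieAlgebra.smooth Y (hle hY), fun Y hY Z hZ => ?_⟩,
    Submodule.finiteDimensional_of_le hle, fun t => ?_⟩
  · refine Submodule.mem_sInf.2 fun W hW => ?_
    exact hW.1.lie_mem Y (Submodule.mem_sInf.1 hY W hW) Z (Submodule.mem_sInf.1 hZ W hW)
  · exact Submodule.mem_sInf.2 fun W hW => hW.2 t

end LieSystems

section Projection

variable {E : Type*} [NormedAddCommGroup E] [NormedSpace ℝ E] [FiniteDimensional ℝ E]
  {M : Type*} [TopologicalSpace M] [ChartedSpace E M] [IsManifold 𝓘(ℝ, E) ∞ M] [T2Space M] {k : ℕ}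
  {η : DForm E M 1 k}
  {F : Type*} [NormedAddCommGroup F] [NormedSpace ℝ F]
  [ChartedSpace F (LeafSpace η)] [IsManifold 𝓘(ℝ, F) ∞ (LeafSpace η)]

/-- `dη = p^* Ω` turns `ι_Y dη = dh` into `ι_{Y'} Ω = dg`, where the Hamiltonian `h` of `Y` descends
to `g` because `dh` vanishes on `ker dη`. -/
theorem IsEtaHamiltonian.exists_related (hη : IsKContactForm η)
    (hp : Manifold.IsSubmersion 𝓘(ℝ, E) 𝓘(ℝ, F) ∞ (leafProj η)) {Ω : DForm F (LeafSpace η) 2 k}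
    (hΩ : pullbackForm (leafProj η) Ω = dExt η) {Y : VField E M} (hY : IsEtaHamiltonian η Y)
    (hR : ∀ R : Fin k → VField E M, IsReebFamily η R →
      ∀ α x, mvfderiv 𝓘(ℝ, E) (hamFun η Y) x (R α x) = 0) :
    ∃ Y' : VField F (LeafSpace η), Related (leafProj η) Y Y' ∧ IsOmegaHamiltonian Ω Y' := by
  have hsurj := leafProj_surjective η
  have hdh := hY.dExt_apply hη hR
  have hh : ContMDiff 𝓘(ℝ, E) 𝓘(ℝ, Fin k → ℝ) ∞ (hamFun η Y) :=
    (hη.smooth.contMDiff_apply hY.smooth).neg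
  have hdker : ∀ x (v : E), v ∈ kerForm (dExt η) x → mfd E (Fin k → ℝ) (hamFun η Y) x v = 0 :=
    fun x v hv => by rw [← hdh, two_form_swap, (mem_kerForm_two (E := E)).1 hv, neg_zero]
  obtain ⟨g, hg, hgh⟩ := exists_contMDiff_comp_eq hp hsurj hh fun _ _ hxy =>
    eq_of_leafProj_eq (hh.mdifferentiable (by simp)) hdker hxy
  have hdg : ∀ x v, formAt (pullbackForm (leafProj η) Ω) x ![vecAt Y x, v] =
      mfd F (Fin k → ℝ) g (leafProj η x) (mfd E F (leafProj η) x v) := fun x v => by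
    rw [hΩ, hdh, ← mfd_comp_apply (hg.mdifferentiableAt (by simp))
      (hp.contMDiff.mdifferentiableAt (by simp))]
    exact DFunLike.congr_fun (mfd_congr (.of_forall fun z => (hgh z).symm)) v
  obtain ⟨Y', hYY', hY'⟩ := exists_related_of_pullbackForm (β := mfd F (Fin k → ℝ) g) hsurj
    (surjective_mfd_of_isSubmersion hp) (hη.isKSymplecticForm hp hΩ).nondegenerate hdg
  exact ⟨Y', hYY', hY.smooth.of_related hp hsurj hYY', g, hg, hY'⟩

end Projection

end KContact

end

open KContact in
theorem mainTheorem2_general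
    {E : Type*} [NormedAddCommGroup E] [NormedSpace ℝ E] [FiniteDimensional ℝ E]
    {M : Type*} [TopologicalSpace M] [ChartedSpace E M] [IsManifold 𝓘(ℝ, E) ∞ M] [T2Space M]
    {k : ℕ} (η : DForm E M 1 k) (X : ℝ → VField E M) (hX : IsProjectable η X)
    {F : Type*} [NormedAddCommGroup F] [NormedSpace ℝ F] [FiniteDimensional ℝ F]
    [ChartedSpace F (LeafSpace η)] [IsManifold 𝓘(ℝ, F) ∞ (LeafSpace η)]
    (hp : Manifold.IsSubmersion 𝓘(ℝ, E) 𝓘(ℝ, F) ∞ (leafProj η)) :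
    ∃ Ω : DForm F (LeafSpace η) 2 k,
      pullbackForm (leafProj η) Ω = dExt η ∧
      (∀ Ω' : DForm F (LeafSpace η) 2 k, pullbackForm (leafProj η) Ω' = dExt η → Ω' = Ω) ∧
      IsKSymplecticForm Ω ∧
      ∃ X' : ℝ → VField F (LeafSpace η),
        IsPushforward (leafProj η) X X' ∧
        (∀ X'' : ℝ → VField F (LeafSpace η), IsPushforward (leafProj η) X X'' → X'' = X') ∧
        IsKSymplecticLieSystem Ω X' ∧
        (∀ t, IsOmegaHamiltonian Ω (X' t)) ∧
        (IsJointlySmooth X → IsJointlySmooth X') := by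
  have hη := hX.kcontact
  have hsurj := leafProj_surjective η
  have hdsurj := surjective_mfd_of_isSubmersion hp
  obtain ⟨Ω, hΩ⟩ := exists_pullbackForm_eq hsurj hdsurj fun _ _ => hη.sameValues_dExt hp
  have hsymplectic := hη.isKSymplecticForm hp hΩ
  have hV := hX.lieSystem.isVessiotGuldberg_smallestLieAlgebra
  have hproj : ∀ Y ∈ smallestLieAlgebra X, ∃ Y' : VField F (LeafSpace η),
      Related (leafProj η) Y Y' ∧ IsOmegaHamiltonian Ω Y' := fun Y hY =>
    (hX.hamiltonian Y hY).exists_related hη hp hΩ (hX.first_integral Y hY)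
  obtain ⟨L, hL⟩ := exists_linearMap_related (V := smallestLieAlgebra X) hsurj
    fun Y hY => (hproj Y hY).imp fun _ => And.left
  have hham : ∀ Y ∈ smallestLieAlgebra X, IsOmegaHamiltonian Ω (L Y) := fun Y hY => by
    obtain ⟨Y', hYY', hY'⟩ := hproj Y hY
    rwa [(hL Y hY).unique hsurj hYY']
  have hLX : ∀ t, Related (leafProj η) (X t) (L (X t)) := fun t => hL (X t) (hV.mem t)
  exact ⟨Ω, hΩ, fun _ hΩ' => pullbackForm_injective hsurj hdsurj (hΩ'.trans hΩ.symm), hsymplectic,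
    fun t => L (X t), hLX, fun _ hX'' => funext fun t => Related.unique hsurj (hX'' t) (hLX t),
    ⟨hsymplectic, _, hV.map hp hsurj hL, Set.forall_mem_image.2 hham⟩,
    fun t => hham (X t) (hV.mem t), fun hJ => hJ.of_related hp hsurj hLX⟩

theorem mainTheorem2
    {E : Type*} [NormedAddCommGroup E] [NormedSpace ℝ E] [FiniteDimensional ℝ E]
    {M : Type*} [TopologicalSpace M] [ChartedSpace E M] [IsManifold 𝓘(ℝ, E) ∞ M]
    [T2Space M] [ConnectedSpace M]
    {k : ℕ} (hk : 1 ≤ k)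
    (η : KContact.DForm E M 1 k) (X : ℝ → KContact.VField E M)
    (hX : KContact.IsProjectable η X)
    {F : Type*} [NormedAddCommGroup F] [NormedSpace ℝ F] [FiniteDimensional ℝ F]
    [ChartedSpace F (KContact.LeafSpace η)] [IsManifold 𝓘(ℝ, F) ∞ (KContact.LeafSpace η)]
    [T2Space (KContact.LeafSpace η)]
    (hp : Manifold.IsSubmersion 𝓘(ℝ, E) 𝓘(ℝ, F) ∞ (KContact.leafProj η)) :
    ∃ Ω : KContact.DForm F (KContact.LeafSpace η) 2 k,
      KContact.pullbackForm (KContact.leafProj η) Ω = KContact.dExt η ∧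
      (∀ Ω' : KContact.DForm F (KContact.LeafSpace η) 2 k,
        KContact.pullbackForm (KContact.leafProj η) Ω' = KContact.dExt η → Ω' = Ω) ∧
      KContact.IsKSymplecticForm Ω ∧
      ∃ X' : ℝ → KContact.VField F (KContact.LeafSpace η),
        KContact.IsPushforward (KContact.leafProj η) X X' ∧
        (∀ X'' : ℝ → KContact.VField F (KContact.LeafSpace η),
          KContact.IsPushforward (KContact.leafProj η) X X'' → X'' = X') ∧
        KContact.IsKSymplecticLieSystem Ω X' ∧
        (∀ t, KContact.IsOmegaHamiltonian Ω (X' t)) ∧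
        (KContact.IsJointlySmooth X → KContact.IsJointlySmooth X') :=
  mainTheorem2_general η X hX hp
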